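/- Let $n\ge 1$, let $X_1,\dots,X_n$ be independent real random variables and write $T_m=\sum_{i=n-m+1}^{n}X_i$ for the sum of the last $m$ of them ($T_0=0$), so that $T_n=\sum_{i=1}^nX_i$. For functions $w_m:\mathbb R\to[0,\infty)$ (the pmf, or a bounded density, of $T_m$) consider the following recursive randomized algorithm, called with the laws of the last $m$ variables $Y_1,\dots,Y_m$ (where $Y_i=X_{n-m+i}$) and a target sum $k\in\mathbb R$; the initial call has $m=n$. * If $m=1$, return $k$; if $m=0$, return the empty tuple. * If $m\ge2$: choose any $r\in\{1,\dots,m\}$ (the choice may depend arbitrarily on $m$, on $k$ and on the number of restarts of the current call so far). Sample $a=(Y_1,\dots,Y_r)$ from their laws, independently, and, independently of $a$, a uniform variable $U$ on $[0,1]$; put $s=a_1+\dots+a_r$ and $$t(a)=\frac{w_{m-r}(k-s)}{\sup_{\eta}w_{m-r}(\eta)} .$$ If $U\ge t(a)$, restart the current call with fresh randomness. Otherwise call the algorithm recursively on the laws of the remaining $m-r$ variables with target sum $k-s$, and return $a$ followed by the tuple that this call returns. Then the algorithm samples exactly from $\mathcal L\big((X_1,\dots,X_n)\,\big|\,\sum_{i=1}^nX_i=k\big)$,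 in each of the following two cases. 1. **Discrete case.** Suppose that every $\mathcal L(X_i)$ is discrete and $w_m(\eta)=\mathbb P(T_m=\eta)$. Then for every $k$ with $\mathbb P(\sum_iX_i=k)>0$ the algorithm terminates almost surely and its return value has the law $\mathcal L\big((X_1,\dots,X_n)\,\big|\,\sum_iX_i=k\big)$. 2. **Bounded-density case.** Suppose that for each $1\le m\le n$ the law of $T_m$ has a bounded density $f_m$, that $w_m=f_m$ for $1\le m\le n$, and that the choices satisfy $r\in\{1,\dots,m-1\}$. (a) For almost every $k$ with respect to the law of $\sum_iX_i$ (equivalently, for Lebesgue-almost every $k$ with $f_n(k)>0$), the algorithm terminates almost surely, and the law of its return value is the value at $k$ of the regular conditional distribution of $(X_1,\dots,X_n)$ given $\sum_iX_i$. (b) If moreover each $X_i$ has a bounded density, then for every $k$ at which $f_n$ is continuous and $f_n(k)>0$, the algorithm terminates almost surely, and the law of its return value is the conditional law at the point $k$, that is, the weak limit, as $\varepsilon\to0^+$, of the law of $(X_1,\dots,X_n)$ conditioned on the event $|\sum_iX_i-k|<\varepsilon$, which has positive probability for every $\varepsilon>0$. -/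

import Mathlib

open MeasureTheory ProbabilityTheory Filter Topology
open scoped ENNReal BoundedContinuousFunction

namespace SumSampler

noncomputable section

/-- A probability law on the line is discrete if it is carried by a countable set. -/
def IsDiscreteLaw (ν : Measure ℝ) : Prop :=
  ∃ C : Set ℝ, C.Countable ∧ ν Cᶜ = 0

/-- `f` is (a version of) a bounded density of the law `ν`. -/
structure IsBoundedDensity (f : ℝ → ℝ) (ν : Measure ℝ) : Prop where
  measurable : Measurable f
  nonneg : ∀ x, 0 ≤ f x
  bounded : ∃ C : ℝ, ∀ x, f x ≤ C
  eq_withDensity : ν = volume.withDensity (fun x => ENNReal.ofReal (f x))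

/-- The sum of the last `m` of the `n` variables `X 0, …, X (n - 1)`. -/
def tailSum {Ω : Type*} {n : ℕ} (X : Fin n → Ω → ℝ) (m : ℕ) (ω : Ω) : ℝ :=
  ∑ i ∈ Finset.univ.filter (fun i : Fin n => n ≤ (i : ℕ) + m), X i ω

/-- The point probabilities `η ↦ P(sum of the last m variables = η)`. -/
def tailPmf {Ω : Type*} [MeasurableSpace Ω] (μ : Measure Ω) {n : ℕ} (X : Fin n → Ω → ℝ)
    (m : ℕ) (η : ℝ) : ℝ :=
  μ.real {ω | tailSum X m ω = η}

/-- The free choice "let `r` be any value in `{1, …, m}`", made at the start of every attempt of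
every call with `m ≥ 2` variables. It may depend on the number `m` of variables of the call, on
its target sum `k` and on the number `j` of restarts of the call so far. -/
structure SplitRule where
  val : ℕ → ℝ → ℕ → ℕ
  one_le : ∀ m k j, 1 ≤ val m k j
  le : ∀ m k j, 2 ≤ m → val m k j ≤ m

/-- The law of `U`, uniform on `[0, 1]`. -/
def uniformLaw : Measure ℝ := volume.restrict (Set.Icc 0 1)

/-- The law of `(X_1, …, X_r)`, sampled independently from the first `r` of the given laws. -/
def headLaw {n : ℕ} (P : Fin n → Measure ℝ) (r : ℕ) (h : r ≤ n) : Measure (Fin r → ℝ) :=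
  Measure.pi fun i => P (Fin.castLE h i)

/-- The list of laws that remains when the first `r` are dropped. -/
def dropLaws {n : ℕ} (P : Fin n → Measure ℝ) (r : ℕ) : Fin (n - r) → Measure ℝ :=
  fun i => P ⟨r + i, by omega⟩

/-- The concatenated tuple `(a_1, …, a_r, b_1, …, b_{n-r})`. -/
def concat {n r : ℕ} (h : r ≤ n) (a : Fin r → ℝ) (b : Fin (n - r) → ℝ) : Fin n → ℝ :=
  fun i => if hi : (i : ℕ) < r then a ⟨i, hi⟩ else b ⟨i - r, by omega⟩

/-- The acceptance threshold `t(a)` in a call with `n` variables and target sum `k`, when the first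
`r` variables have the values `a`; here `w m` is the pmf, or the density, of the sum of the last
`m` variables. -/
def threshold (w : ℕ → ℝ → ℝ) (n : ℕ) (k : ℝ) {r : ℕ} (a : Fin r → ℝ) : ℝ :=
  w (n - r) (k - ∑ i, a i) / ⨆ η, w (n - r) η

/-- The part of the law `Q` of a proposal `a` that survives the test: `a` together with an
independent uniform `U` with `U < t(a)`. Its mass is the probability of acceptance. -/
def acceptedPart {β : Type*} [MeasurableSpace β] (Q : Measure β) (t : β → ℝ) : Measure β :=
  ((Q.prod uniformLaw).restrict {p | p.2 < t p.1}).map Prod.fst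

/-- The probability that a proposal `a` with law `Q` is rejected: `U ≥ t(a)`. -/
def rejectProb {β : Type*} [MeasurableSpace β] (Q : Measure β) (t : β → ℝ) : ℝ≥0∞ :=
  (Q.prod uniformLaw) {p | t p.1 ≤ p.2}

/-- The law of the return value of "repeat until accepted" with fresh randomness in each attempt:
attempt `j` is rejected with probability `rej j`, and `out j` is the (sub-probability) law of what
is returned from an accepted attempt `j`. Attempt `j` takes place if all earlier ones were rejected.
The missing mass, if any, is the probability that nothing is ever returned. -/
def restartLoop {β : Type*} [MeasurableSpace β] (rej : ℕ → ℝ≥0∞) (out : ℕ → Measure β) :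
    Measure β :=
  Measure.sum fun j => (∏ i ∈ Finset.range j, rej i) • out j

/-- The law of the return value of the recursive sampling algorithm, called with the laws `P` of
`n` independent variables and the target sum `k`. One variable: return `k`. No variable (reached
only after the choice `r = n`): return the empty tuple. Otherwise repeat: choose `r`, sample
`a = (X_1, …, X_r)`, restart if `U ≥ t(a)`; else call the algorithm on the remaining laws with
target `k - (a_1 + ⋯ + a_r)` and append the tuple it returns to `a`. -/
def sampler (w : ℕ → ℝ → ℝ) (ρ : SplitRule) :
    (n : ℕ) → (Fin n → Measure ℝ) → ℝ → Measure (Fin n → ℝ)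
  | 0, _, _ => Measure.dirac Fin.elim0
  | 1, _, k => Measure.dirac fun _ => k
  | n + 2, P, k =>
    restartLoop
      (fun j =>
        rejectProb (headLaw P (ρ.val (n + 2) k j) (ρ.le (n + 2) k j (by omega)))
          (threshold w (n + 2) k))
      (fun j =>
        (acceptedPart (headLaw P (ρ.val (n + 2) k j) (ρ.le (n + 2) k j (by omega)))
          (threshold w (n + 2) k)).bind fun a =>
            (sampler w ρ (n + 2 - ρ.val (n + 2) k j) (dropLaws P (ρ.val (n + 2) k j))
              (k - ∑ i, a i)).map (concat (ρ.le (n + 2) k j (by omega)) a))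
  termination_by n => n
  decreasing_by
    have := ρ.one_le (n + 2) k j
    omega

/-- `ν` is the conditional law of `Y` given `S = k`, at the single point `k` (where possibly
`P(S = k) = 0`): the weak limit, as `ε → 0+`, of the law of `Y` conditioned on the events
`|S - k| < ε`, all of which have positive probability. -/
def IsCondLawAt {Ω E : Type*} [MeasurableSpace Ω] [TopologicalSpace E] [MeasurableSpace E]
    (μ : Measure Ω) (Y : Ω → E) (S : Ω → ℝ) (k : ℝ) (ν : Measure E) : Prop :=
  IsProbabilityMeasure ν ∧
  (∀ ε : ℝ, 0 < ε → 0 < μ {ω | |S ω - k| < ε}) ∧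
  ∀ φ : E →ᵇ ℝ,
    Tendsto (fun ε : ℝ => ∫ ω, φ (Y ω) ∂(μ[|{ω | |S ω - k| < ε}])) (𝓝[>] 0) (𝓝 (∫ x, φ x ∂ν))

end

end SumSampler

namespace SumSampler

noncomputable section

section

/-! ### Rejection sampling -/

/-! Let `M m k` be an unnormalized conditional law of the last `m` variables at the sum `k`: in the
discrete case the joint law restricted to the fibre (`fiberLaw`), in the density case the slice
obtained by solving for the last coordinate and weighting with its density (`sliceLaw`). Its mass is
the weight `w m k`, and integrating over the first `r` coordinates `a` expresses `M m k` through `M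
(m - r) (k - ∑ a)` (`fiberLaw_split`, `sliceLaw_split`). The test weights `a` by `w (m - r) (k - ∑
a) / sup w (m - r)`, while the recursive call returns `M (m - r) (k - ∑ a)` divided by its mass. The
mass cancels, so an accepted attempt has law `M m k / sup w (m - r)` (`acceptedPart_bind_eq`). The
choice of `r` affects only the scalar; hence an adaptive choice creates no bias, and
`restartLoop_eq_normalize` gives termination and the normalization of `M m k`. With densities, `f m`
is an arbitrary version and equals the slice mass only almost everywhere, so the recursive targets
`k - ∑ a` must avoid null sets. For almost every `k` this is Fubini (`ae_ae_sub_of_ae`); for a fixed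
`k` it follows from a bounded density of the first variable (`ae_sub_sum_seqLaw`). The normalized
slice is then identified with `condDistrib` by uniqueness of disintegrations, and with the pointwise
conditional law by continuity of the slices in `k`, which comes from `L¹` approximation of the last
density (`continuous_integral_mul_sub`). -/

theorem uniformLaw_Iio {t : ℝ} (h1 : t ≤ 1) : uniformLaw (Set.Iio t) = ENNReal.ofReal t := by
  have : Set.Iio t ∩ Set.Icc (0 : ℝ) 1 = Set.Ico 0 t := by
    ext x
    simp only [Set.mem_inter_iff, Set.mem_Iio, Set.mem_Icc, Set.mem_Ico]
    constructor
    · rintro ⟨h, h', -⟩; exact ⟨h', h⟩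
    · rintro ⟨h, h'⟩; exact ⟨h', h, by linarith⟩
  rw [uniformLaw, Measure.restrict_apply measurableSet_Iio, this, Real.volume_Ico, sub_zero]

instance : IsProbabilityMeasure uniformLaw := ⟨by simp [uniformLaw]⟩

/-- Given `a`, the uniform variable falls below `t a ≤ 1` with probability `ENNReal.ofReal (t a)`,
negative thresholds included. -/
theorem acceptedPart_eq_withDensity {β : Type*} [MeasurableSpace β] (Q : Measure β) [SFinite Q]
    {t : β → ℝ} (ht : Measurable t) (h1 : ∀ a, t a ≤ 1) :
    acceptedPart Q t = Q.withDensity fun a => ENNReal.ofReal (t a) := by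
  have hset : MeasurableSet {p : β × ℝ | p.2 < t p.1} :=
    measurableSet_lt measurable_snd (ht.comp measurable_fst)
  ext s hs
  rw [acceptedPart, Measure.map_apply measurable_fst hs,
    Measure.restrict_apply (measurable_fst hs),
    Measure.prod_apply ((measurable_fst hs).inter hset), withDensity_apply _ hs,
    ← lintegral_indicator hs]
  refine lintegral_congr fun a => ?_
  by_cases ha : a ∈ s
  · rw [Set.indicator_of_mem ha, ← uniformLaw_Iio (h1 a)]
    congr 1
    ext u
    simp [ha]
  · rw [Set.indicator_of_notMem ha]
    convert measure_empty (μ := uniformLaw)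
    ext u
    simp [ha]

theorem rejectProb_add_acceptedPart {β : Type*} [MeasurableSpace β] (Q : Measure β)
    [IsProbabilityMeasure Q] {t : β → ℝ} (ht : Measurable t) :
    rejectProb Q t + acceptedPart Q t Set.univ = 1 := by
  have hset : MeasurableSet {p : β × ℝ | p.2 < t p.1} :=
    measurableSet_lt measurable_snd (ht.comp measurable_fst)
  have hc : {p : β × ℝ | t p.1 ≤ p.2} = {p : β × ℝ | p.2 < t p.1}ᶜ := by
    ext p; simp
  rw [acceptedPart, Measure.map_apply measurable_fst MeasurableSet.univ, Set.preimage_univ,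
    Measure.restrict_apply_univ, rejectProb, hc, add_comm, measure_add_measure_compl hset,
    measure_univ]

/-- The partial sums telescope to one minus the probability of `N` successive rejections, which is
at most `(1 - δ) ^ N`. The uniform bound `δ` matters because the acceptance probability may change
from one restart to the next. -/
theorem tsum_prod_mul_eq_one {q p : ℕ → ℝ≥0∞} {δ : ℝ≥0∞} (hδ : δ ≠ 0)
    (hqp : ∀ j, q j + p j = 1) (hp : ∀ j, δ ≤ p j) :
    ∑' j, (∏ i ∈ Finset.range j, q i) * p j = 1 := by
  have hsum : ∀ N, ∑ j ∈ Finset.range N, (∏ i ∈ Finset.range j, q i) * p j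
      + ∏ i ∈ Finset.range N, q i = 1 := by
    intro N
    induction N with
    | zero => simp
    | succ N ih =>
      rw [Finset.sum_range_succ, Finset.prod_range_succ, add_assoc, ← mul_add, add_comm (p N),
        hqp, mul_one, ih]
  have hq : ∀ j, q j ≤ 1 - δ := fun j => by
    have hpt : p j ≠ ∞ := ne_top_of_le_ne_top ENNReal.one_ne_top ((hqp j) ▸ le_add_self)
    rw [ENNReal.eq_sub_of_add_eq hpt (hqp j)]
    exact tsub_le_tsub_left (hp j) 1
  have hprod : Tendsto (fun N => ∏ i ∈ Finset.range N, q i) atTop (𝓝 0) := by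
    refine tendsto_of_tendsto_of_tendsto_of_le_of_le tendsto_const_nhds
      (ENNReal.tendsto_pow_atTop_nhds_zero_of_lt_one
        (ENNReal.sub_lt_self ENNReal.one_ne_top one_ne_zero hδ)) (fun _ => zero_le) fun N => ?_
    calc ∏ i ∈ Finset.range N, q i ≤ ∏ _i ∈ Finset.range N, (1 - δ) :=
          Finset.prod_le_prod' fun i _ => hq i
      _ = (1 - δ) ^ N := by simp
  have h1 := (ENNReal.tendsto_nat_tsum fun j => (∏ i ∈ Finset.range j, q i) * p j).add hprod
  simp only [hsum, add_zero] at h1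
  exact (tendsto_nhds_unique h1 tendsto_const_nhds)

/-- If every attempt returns a multiple of the same measure `M`, with multiples bounded below, then
the loop terminates almost surely and returns the normalization of `M`. -/
theorem restartLoop_eq_normalize {β : Type*} [MeasurableSpace β] {rej : ℕ → ℝ≥0∞}
    {out : ℕ → Measure β} {M : Measure β} {b : ℕ → ℝ≥0∞} {δ : ℝ≥0∞}
    (hM0 : M Set.univ ≠ 0) (hout : ∀ j, out j = b j • M)
    (hrej : ∀ j, rej j + b j * M Set.univ = 1) (hδ : δ ≠ 0) (hb : ∀ j, δ ≤ b j) :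
    restartLoop rej out = (M Set.univ)⁻¹ • M := by
  have h1 := tsum_prod_mul_eq_one (mul_ne_zero hδ hM0) hrej
    (fun j => mul_le_mul_left (hb j) _)
  simp only [← mul_assoc] at h1
  rw [ENNReal.tsum_mul_right] at h1
  have h2 : ∑' j, (∏ i ∈ Finset.range j, rej i) * b j = (M Set.univ)⁻¹ :=
    ENNReal.eq_inv_of_mul_eq_one_left h1
  ext s hs
  rw [restartLoop, Measure.sum_apply _ hs, Measure.smul_apply, smul_eq_mul, ← h2,
    ← ENNReal.tsum_mul_right]
  refine tsum_congr fun j => ?_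
  rw [hout]
  simp [mul_assoc]

/-! ### Independent coordinates numbered from the end -/

/-- The laws of the last `m` variables, `Q i` being the law of the variable with `i` successors. -/
def tailLaws (Q : ℕ → Measure ℝ) (m : ℕ) : Fin m → Measure ℝ := fun i => Q (m - 1 - i)

/-- The joint law of the first `p` of the last `m` variables. -/
def seqLaw (Q : ℕ → Measure ℝ) (m p : ℕ) : Measure (Fin p → ℝ) :=
  Measure.pi fun i => Q (m - 1 - i)

/-- The tuple `a` followed by the tuple `b`. -/
def join {p r l : ℕ} (h : p = r + l) (a : Fin r → ℝ) (b : Fin l → ℝ) : Fin p → ℝ :=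
  fun i => if hi : (i : ℕ) < r then a ⟨i, hi⟩ else b ⟨i - r, by omega⟩

/-- This is the purpose of numbering from the end: a recursive call changes `m` but not `Q`, so the
induction can keep `Q` fixed. -/
theorem dropLaws_tailLaws (Q : ℕ → Measure ℝ) (m r : ℕ) :
    dropLaws (tailLaws Q m) r = tailLaws Q (m - r) := by
  funext i
  simp only [dropLaws, tailLaws]
  congr 1
  omega

theorem measurable_join {p r l : ℕ} (h : p = r + l) :
    Measurable fun x : (Fin r → ℝ) × (Fin l → ℝ) => join h x.1 x.2 := by
  refine measurable_pi_lambda _ fun i => ?_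
  unfold join
  split_ifs <;> fun_prop

theorem measurable_join_right {p r l : ℕ} (h : p = r + l) (a : Fin r → ℝ) :
    Measurable (join h a : (Fin l → ℝ) → Fin p → ℝ) :=
  (measurable_join h).comp measurable_prodMk_left

theorem sum_join {p r l : ℕ} (h : p = r + l) (a : Fin r → ℝ) (b : Fin l → ℝ) :
    ∑ i, join h a b i = ∑ i, a i + ∑ i, b i := by
  subst h
  rw [Fin.sum_univ_add]
  simp [join]

theorem join_assoc {p q r l s : ℕ} (h₁ : p = q + s) (h₂ : q = r + l) (h₃ : p = r + (l + s))
    (a : Fin r → ℝ) (b : Fin l → ℝ) (c : Fin s → ℝ) :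
    join h₁ (join h₂ a b) c = join h₃ a (join rfl b c) := by
  funext i
  simp only [join]
  split_ifs <;> first | rfl | omega | skip
  congr 2
  omega

variable (Q : ℕ → Measure ℝ) [∀ i, IsProbabilityMeasure (Q i)]

instance (m p : ℕ) : IsProbabilityMeasure (seqLaw Q m p) := by
  unfold seqLaw; infer_instance

theorem map_join_seqLaw {p r l : ℕ} (m : ℕ) (h : p = r + l) :
    ((seqLaw Q m r).prod (seqLaw Q (m - r) l)).map (fun x => join h x.1 x.2) = seqLaw Q m p := by
  subst h
  symm
  refine Measure.pi_eq fun s hs => ?_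
  rw [Measure.map_apply (measurable_join rfl) (MeasurableSet.univ_pi hs), Fin.prod_univ_add]
  have : (fun x : (Fin r → ℝ) × (Fin l → ℝ) => join (rfl : r + l = r + l) x.1 x.2) ⁻¹'
      Set.univ.pi s = (Set.univ.pi fun i => s (Fin.castAdd l i)) ×ˢ
        (Set.univ.pi fun i => s (Fin.natAdd r i)) := by
    ext x
    simp only [Set.mem_preimage, Set.mem_univ_pi, Set.mem_prod]
    constructor
    · intro hx
      refine ⟨fun i => ?_, fun i => ?_⟩
      · simpa [join] using hx (Fin.castAdd l i)
      · simpa [join] using hx (Fin.natAdd r i)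
    · rintro ⟨h1, h2⟩ i
      refine Fin.addCases (fun i => ?_) (fun i => ?_) i
      · simpa [join] using h1 i
      · simpa [join] using h2 i
  rw [this, Measure.prod_prod, seqLaw, seqLaw, Measure.pi_pi, Measure.pi_pi]
  congr 1
  refine Finset.prod_congr rfl fun i _ => ?_
  congr 2
  simp only [Fin.val_natAdd]
  omega

theorem lintegral_seqLaw_join {p r l : ℕ} (m : ℕ) (h : p = r + l) {F : (Fin p → ℝ) → ℝ≥0∞}
    (hF : Measurable F) :
    ∫⁻ x, F x ∂seqLaw Q m p =
      ∫⁻ a, ∫⁻ b, F (join h a b) ∂seqLaw Q (m - r) l ∂seqLaw Q m r := by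
  rw [← map_join_seqLaw Q m h, lintegral_map hF (measurable_join h),
    lintegral_prod (fun x : (Fin r → ℝ) × (Fin l → ℝ) => F (join h x.1 x.2))
      (hF.comp (measurable_join h)).aemeasurable]

/-! ### The recursion step -/

theorem measurable_kernel_join {p r l : ℕ} (h : p = r + l) (κ : Kernel ℝ (Fin l → ℝ))
    [IsSFiniteKernel κ] (k : ℝ) :
    Measurable fun a : Fin r → ℝ => (κ (k - ∑ i, a i)).map (join h a) := by
  have hm : Measurable fun a : Fin r → ℝ => k - ∑ i, a i := by fun_prop
  refine Measure.measurable_of_measurable_coe _ fun s hs => ?_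
  simp_rw [Measure.map_apply (measurable_join_right h _) hs]
  exact Kernel.measurable_kernel_prodMk_left (κ := κ.comap _ hm) (measurable_join h hs)

/-- An accepted attempt returns a multiple of the target measure `N`, if the rejection test uses the
masses of the measures `κ x` and the recursive call normalizes them. -/
theorem acceptedPart_bind_eq {m r l : ℕ} (h : m = r + l) {k : ℝ} {w : ℝ → ℝ}
    {S : ℝ → Measure (Fin l → ℝ)} {κ : Kernel ℝ (Fin l → ℝ)} [IsFiniteKernel κ]
    {N : Measure (Fin m → ℝ)} (hw : Measurable w)
    (hwC : BddAbove (Set.range w)) (hc : 0 < ⨆ η, w η)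
    (hsplit : ∀ s, MeasurableSet s →
      N s = ∫⁻ a, κ (k - ∑ i, a i) (join h a ⁻¹' s) ∂seqLaw Q m r)
    (hmass : ∀ᵐ a ∂seqLaw Q m r,
      ENNReal.ofReal (w (k - ∑ i, a i)) = κ (k - ∑ i, a i) Set.univ)
    (hrec : ∀ᵐ a ∂seqLaw Q m r, κ (k - ∑ i, a i) Set.univ ≠ 0 →
      S (k - ∑ i, a i) = (κ (k - ∑ i, a i) Set.univ)⁻¹ • κ (k - ∑ i, a i)) :
    (acceptedPart (seqLaw Q m r) fun a => w (k - ∑ i, a i) / ⨆ η, w η).bind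
        (fun a => (S (k - ∑ i, a i)).map (join h a)) = (ENNReal.ofReal (⨆ η, w η))⁻¹ • N ∧
      acceptedPart (seqLaw Q m r) (fun a => w (k - ∑ i, a i) / ⨆ η, w η) Set.univ =
        (ENNReal.ofReal (⨆ η, w η))⁻¹ * N Set.univ := by
  set c := ⨆ η, w η
  have hm : Measurable fun a : Fin r → ℝ => k - ∑ i, a i := by fun_prop
  have ht : Measurable fun a : Fin r → ℝ => w (k - ∑ i, a i) / c := (hw.comp hm).div_const c
  have hof : ∀ a : Fin r → ℝ, ENNReal.ofReal (w (k - ∑ i, a i) / c) =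
      (ENNReal.ofReal c)⁻¹ * ENNReal.ofReal (w (k - ∑ i, a i)) := fun a => by
    rw [ENNReal.ofReal_div_of_pos hc, ENNReal.div_eq_inv_mul]
  have hci : (ENNReal.ofReal c)⁻¹ ≠ ∞ := by simpa using hc
  rw [acceptedPart_eq_withDensity _ ht fun a => div_le_one_of_le₀ (le_ciSup hwC _) hc.le]
  set g : (Fin r → ℝ) → Measure (Fin m → ℝ) := fun a =>
    (κ (k - ∑ i, a i) Set.univ)⁻¹ • (κ (k - ∑ i, a i)).map (join h a) with hg
  have hgm : ∀ s, MeasurableSet s → Measurable fun a => g a s := fun s hs =>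
    (((κ.measurable_coe MeasurableSet.univ).comp hm).inv).mul
      (Measure.measurable_measure.1 (measurable_kernel_join h κ k) s hs)
  constructor
  · rw [Measure.bind_congr_right (g := g)]
    · ext s hs
      rw [Measure.bind_apply hs (Measure.measurable_of_measurable_coe _ hgm).aemeasurable,
        lintegral_withDensity_eq_lintegral_mul _ ht.ennreal_ofReal (hgm s hs),
        Measure.smul_apply, smul_eq_mul, hsplit s hs, ← lintegral_const_mul' _ _ hci]
      refine lintegral_congr_ae ?_
      filter_upwards [hmass] with a ha
      simp only [Pi.mul_apply, hg, Measure.smul_apply, smul_eq_mul, hof, ha,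
        Measure.map_apply (measurable_join_right h _) hs]
      -- Where the mass vanishes, its inverse is `∞`, but both sides are still zero.
      by_cases h0 : κ (k - ∑ i, a i) Set.univ = 0
      · rw [measure_mono_null (Set.subset_univ _) h0]
        simp [measure_mono_null (Set.subset_univ _) h0]
      · rw [mul_assoc, ← mul_assoc (κ _ _), ENNReal.mul_inv_cancel h0 (measure_ne_top _ _),
          one_mul]
    -- Only accepted proposals reach the recursive call, and they have nonzero remaining mass; this
    -- is why `hrec` may assume it.
    · refine (ae_withDensity_iff ht.ennreal_ofReal).2 ?_
      filter_upwards [hmass, hrec] with a ha hr h0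
      rw [hof, ha] at h0
      simp only [hg]
      rw [hr (right_ne_zero_of_mul h0), Measure.map_smul]
  · rw [withDensity_apply _ MeasurableSet.univ, Measure.restrict_univ, hsplit _ MeasurableSet.univ]
    simp_rw [hof]
    rw [lintegral_const_mul' _ _ hci]
    congr 1
    refine lintegral_congr_ae ?_
    filter_upwards [hmass] with a ha
    rw [ha, Set.preimage_univ]

/-- One level of the recursion. `M l k` is an unnormalized version of the conditional law of the
last `l` variables at the sum `k`. -/
theorem sampler_tailLaws_step (w : ℕ → ℝ → ℝ) (ρ : SplitRule)
    (M : (l : ℕ) → Kernel ℝ (Fin l → ℝ)) [∀ l, IsFiniteKernel (M l)] {m : ℕ} (hm : 2 ≤ m) {k : ℝ}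
    (hk : M m k Set.univ ≠ 0)
    (hw : ∀ j, Measurable (w (m - ρ.val m k j)))
    (hw0 : ∀ j x, 0 ≤ w (m - ρ.val m k j) x)
    (hwC : ∀ j, BddAbove (Set.range (w (m - ρ.val m k j))))
    (hsplit : ∀ j l (h : m = ρ.val m k j + l) s, MeasurableSet s → M m k s =
      ∫⁻ a, M l (k - ∑ i, a i) (join h a ⁻¹' s) ∂seqLaw Q m (ρ.val m k j))
    (hmass : ∀ j, ∀ᵐ a ∂seqLaw Q m (ρ.val m k j),
      ENNReal.ofReal (w (m - ρ.val m k j) (k - ∑ i, a i)) =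
        M (m - ρ.val m k j) (k - ∑ i, a i) Set.univ)
    (hrec : ∀ j, ∀ᵐ a ∂seqLaw Q m (ρ.val m k j),
      M (m - ρ.val m k j) (k - ∑ i, a i) Set.univ ≠ 0 →
      sampler w ρ (m - ρ.val m k j) (tailLaws Q (m - ρ.val m k j)) (k - ∑ i, a i) =
        (M (m - ρ.val m k j) (k - ∑ i, a i) Set.univ)⁻¹ •
          M (m - ρ.val m k j) (k - ∑ i, a i)) :
    sampler w ρ m (tailLaws Q m) k = (M m k Set.univ)⁻¹ • M m k := by
  obtain ⟨m, rfl⟩ : ∃ n, m = n + 2 := ⟨m - 2, by omega⟩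
  have hr : ∀ j, m + 2 = ρ.val (m + 2) k j + (m + 2 - ρ.val (m + 2) k j) := fun j => by
    have := ρ.le (m + 2) k j hm
    omega
  -- If the supremum were zero, all remaining masses would vanish almost surely, and by `hsplit` so
  -- would the mass of `M (m + 2) k`.
  have hc : ∀ j, 0 < ⨆ η, w (m + 2 - ρ.val (m + 2) k j) η := by
    intro j
    refine lt_of_le_of_ne (Real.iSup_nonneg (hw0 j)) fun h0 => hk ?_
    rw [hsplit j _ (hr j) _ MeasurableSet.univ, ← lintegral_zero (μ := seqLaw Q (m + 2) _)]
    refine lintegral_congr_ae ?_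
    filter_upwards [hmass j] with a ha
    rw [Set.preimage_univ, ← ha]
    exact ENNReal.ofReal_of_nonpos (h0 ▸ le_ciSup (hwC j) _)
  have key := fun j => acceptedPart_bind_eq Q (hr j) (hw j) (hwC j) (hc j)
    (hsplit j _ (hr j)) (hmass j) (hrec j)
  rw [sampler]
  simp_rw [dropLaws_tailLaws]
  -- `key` applies after unfolding: `headLaw` of `tailLaws` is `seqLaw`, and `concat` is `join`.
  -- Only the suprema with index at most `m + 2` can occur, so the inverse of their finite sum
  -- bounds every factor `b j` from below.
  refine restartLoop_eq_normalize
    (b := fun j => (ENNReal.ofReal (⨆ η, w (m + 2 - ρ.val (m + 2) k j) η))⁻¹)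
    (δ := (∑ l ∈ Finset.range (m + 3), ENNReal.ofReal (⨆ η, w l η))⁻¹)
    hk (fun j => (key j).1) (fun j => ?_) ?_ fun j => ?_
  · rw [← (key j).2]
    exact rejectProb_add_acceptedPart (seqLaw Q (m + 2) (ρ.val (m + 2) k j))
      (((hw j).comp (by fun_prop)).div_const _)
  · simp [ENNReal.sum_eq_top]
  · exact ENNReal.inv_le_inv.2 (Finset.single_le_sum
      (f := fun l => ENNReal.ofReal (⨆ η, w l η)) (fun _ _ => zero_le) (by simp; omega))

end

section

variable (Q : ℕ → Measure ℝ) [∀ i, IsProbabilityMeasure (Q i)]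

/-! ### Point masses of the sum -/

/-- The joint law of the last `l` variables, restricted to the event that their sum is `k`. -/
def fiberLaw (l : ℕ) : Kernel ℝ (Fin l → ℝ) where
  toFun k := (seqLaw Q l l).restrict {x | ∑ i, x i = k}
  measurable' := by
    refine Measure.measurable_of_measurable_coe _ fun s hs => ?_
    simp_rw [Measure.restrict_apply hs]
    refine measurable_measure_prodMk_left (ν := seqLaw Q l l)
      (s := {p : ℝ × (Fin l → ℝ) | p.2 ∈ s ∧ ∑ i, p.2 i = p.1}) ?_
    exact (measurable_snd hs).inter (measurableSet_eq_fun (by fun_prop) measurable_fst)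

theorem measurableSet_sum_eq {l : ℕ} (k : ℝ) : MeasurableSet {x : Fin l → ℝ | ∑ i, x i = k} :=
  measurableSet_eq_fun (by fun_prop) measurable_const

theorem fiberLaw_apply (l : ℕ) (k : ℝ) :
    fiberLaw Q l k = (seqLaw Q l l).restrict {x | ∑ i, x i = k} := rfl

instance (l : ℕ) : IsFiniteKernel (fiberLaw Q l) :=
  ⟨1, ENNReal.one_lt_top, fun k => by
    rw [fiberLaw_apply, Measure.restrict_apply_univ]; exact prob_le_one⟩

/-- Fubini: with the head `a` fixed, the condition on the total sum becomes a condition on the tail,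
with target `k - ∑ a`. An empty tail (`l = 0`) is allowed. -/
theorem fiberLaw_split {m r l : ℕ} (h : m = r + l) (k : ℝ) {s : Set (Fin m → ℝ)}
    (hs : MeasurableSet s) :
    fiberLaw Q m k s = ∫⁻ a, fiberLaw Q l (k - ∑ i, a i) (join h a ⁻¹' s) ∂seqLaw Q m r := by
  have hml : m - r = l := by omega
  have hms := hs.inter (measurableSet_sum_eq (l := m) k)
  rw [fiberLaw_apply, Measure.restrict_apply hs, ← lintegral_indicator_one hms,
    lintegral_seqLaw_join Q m h (measurable_one.indicator hms)]
  refine lintegral_congr fun a => ?_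
  rw [fiberLaw_apply, Measure.restrict_apply (measurable_join_right h a hs), hml,
    ← lintegral_indicator_one ((measurable_join_right h a hs).inter (measurableSet_sum_eq _))]
  refine lintegral_congr fun b => ?_
  have hiff : join h a b ∈ s ∩ {x | ∑ i, x i = k} ↔
      b ∈ join h a ⁻¹' s ∩ {x | ∑ i, x i = k - ∑ i, a i} := by
    refine and_congr Iff.rfl ?_
    change ∑ i, join h a b i = k ↔ ∑ i, b i = k - ∑ i, a i
    rw [sum_join, eq_sub_iff_add_eq']
  by_cases hb : b ∈ join h a ⁻¹' s ∩ {x | ∑ i, x i = k - ∑ i, a i}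
  · rw [Set.indicator_of_mem hb, Set.indicator_of_mem (hiff.2 hb)]
    rfl
  · rw [Set.indicator_of_notMem hb, Set.indicator_of_notMem (mt hiff.1 hb)]

theorem fiberLaw_one (k : ℝ) :
    fiberLaw Q 1 k = fiberLaw Q 1 k Set.univ • Measure.dirac fun _ => k := by
  have : {x : Fin 1 → ℝ | ∑ i, x i = k} = {fun _ => k} := by
    ext x
    simp [funext_iff]
  rw [fiberLaw_apply, this, Measure.restrict_singleton]
  simp

/-- Here the weights are the fibre masses at every point, so strong induction works for each
admissible `k` without exceptional sets. -/
theorem sampler_eq_normalize_fiberLaw {w : ℕ → ℝ → ℝ} (ρ : SplitRule) {n : ℕ}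
    (hw : ∀ m ≤ n, ∀ k, w m k = (fiberLaw Q m k).real Set.univ) {m : ℕ} (hm : m ≤ n) {k : ℝ}
    (hk : fiberLaw Q m k Set.univ ≠ 0) :
    sampler w ρ m (tailLaws Q m) k = (fiberLaw Q m k Set.univ)⁻¹ • fiberLaw Q m k := by
  induction m using Nat.strong_induction_on generalizing k with
  | _ m ih =>
    rcases Nat.lt_or_ge m 2 with h2 | h2
    · interval_cases m
      · have h1 : seqLaw Q 0 0 = Measure.dirac Fin.elim0 := by
          rw [seqLaw, Measure.pi_of_empty _ Fin.elim0]
        -- The empty sum is zero, so a fibre of positive mass forces this target.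
        have h0 : ((0 : ℝ) = k) := by
          by_contra h0
          simp [fiberLaw_apply, h0] at hk
        rw [sampler, fiberLaw_apply]
        simp [h0, h1]
      · rw [sampler]
        conv_rhs => rw [fiberLaw_one, smul_smul]
        simp only [Measure.smul_apply, measure_univ, smul_eq_mul, mul_one]
        rw [ENNReal.inv_mul_cancel hk (measure_ne_top _ _), one_smul]
    · have hwl : ∀ j, w (m - ρ.val m k j) =
          fun x => (fiberLaw Q (m - ρ.val m k j) x).real Set.univ :=
        fun j => funext (hw _ (by omega))
      refine sampler_tailLaws_step Q w ρ (fiberLaw Q) h2 hk (fun j => ?_) (fun j x => ?_)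
        (fun j => ?_) (fun j l h s hs => fiberLaw_split Q h k hs)
        (fun j => ae_of_all _ fun a => ?_) (fun j => ae_of_all _ fun a ha => ?_)
      · rw [hwl]
        exact ((fiberLaw Q _).measurable_coe MeasurableSet.univ).ennreal_toReal
      · rw [hwl]
        positivity
      · rw [hwl]
        refine ⟨1, ?_⟩
        rintro _ ⟨x, rfl⟩
        simp only [fiberLaw_apply, measureReal_restrict_apply_univ]
        exact measureReal_le_one
      · rw [hwl]
        exact ENNReal.ofReal_toReal (measure_ne_top _ _)
      · have := ρ.one_le m k j
        exact ih _ (by omega) (by omega) ha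

end

section

theorem lintegral_seqLaw_one (Q : ℕ → Measure ℝ) (m : ℕ) (F : (Fin 1 → ℝ) → ℝ≥0∞) :
    ∫⁻ b, F b ∂seqLaw Q m 1 = ∫⁻ y, F (fun _ => y) ∂Q (m - 1) := by
  have h := measurePreserving_funUnique (Q (m - 1)) (Fin 1)
  have h1 : seqLaw Q m 1 = Measure.pi fun _ : Fin 1 => Q (m - 1) := by
    unfold seqLaw
    congr 1
    funext i
    simp
  rw [h1]
  exact ((h.symm _).lintegral_comp_emb (MeasurableEquiv.measurableEmbedding _) F).symm

variable (Q : ℕ → Measure ℝ) [∀ i, IsProbabilityMeasure (Q i)]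

/-! ### Disintegration along the sum when the last variable has a density -/

/-- The tuple `a` completed by one entry so that its sum becomes `k`. -/
def complete {p : ℕ} (k : ℝ) (a : Fin p → ℝ) : Fin (p + 1) → ℝ :=
  join rfl a fun _ : Fin 1 => k - ∑ i, a i

theorem measurable_complete {p : ℕ} :
    Measurable fun x : ℝ × (Fin p → ℝ) => complete x.1 x.2 :=
  (measurable_join rfl).comp (f := fun x : ℝ × (Fin p → ℝ) =>
    (x.2, fun _ : Fin 1 => x.1 - ∑ i, x.2 i)) (by fun_prop)

theorem measurable_complete_right {p : ℕ} (k : ℝ) :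
    Measurable (complete k : (Fin p → ℝ) → Fin (p + 1) → ℝ) :=
  measurable_complete.comp measurable_prodMk_left

theorem sum_complete {p : ℕ} (k : ℝ) (a : Fin p → ℝ) : ∑ i, complete k a i = k := by
  simp [complete, sum_join]

theorem continuous_complete {p : ℕ} (a : Fin p → ℝ) : Continuous fun k => complete k a := by
  refine continuous_pi fun i => ?_
  unfold complete join
  split_ifs <;> fun_prop

theorem measurable_slice_density {g : ℝ → ℝ≥0∞} (hg : Measurable g) {p : ℕ} :
    Measurable fun x : ℝ × (Fin p → ℝ) => g (x.1 - ∑ i, x.2 i) :=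
  hg.comp (by fun_prop)

theorem lintegral_map_complete {g : ℝ → ℝ≥0∞} (hg : Measurable g) {p : ℕ}
    (μ : Measure (Fin p → ℝ)) (k : ℝ) {F : (Fin (p + 1) → ℝ) → ℝ≥0∞} (hF : Measurable F) :
    ∫⁻ x, F x ∂(μ.withDensity fun a => g (k - ∑ i, a i)).map (complete k) =
      ∫⁻ a, g (k - ∑ i, a i) * F (complete k a) ∂μ := by
  rw [lintegral_map hF (measurable_complete_right k)]
  exact lintegral_withDensity_eq_lintegral_mul _
    ((measurable_slice_density hg).comp (measurable_prodMk_left (x := k)))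
    (hF.comp (measurable_complete_right k))

/-- The joint law of the last `l` variables disintegrated along their sum, if `g` is a density of
the last variable. The mass of `sliceLaw Q hg l k` is the density of the sum at `k`. -/
def sliceLaw {g : ℝ → ℝ≥0∞} (hg : Measurable g) : (l : ℕ) → Kernel ℝ (Fin l → ℝ)
  | 0 => 0
  | p + 1 =>
    { toFun := fun k =>
        ((seqLaw Q (p + 1) p).withDensity fun a => g (k - ∑ i, a i)).map (complete k)
      measurable' := by
        refine Measure.measurable_of_measurable_coe _ fun s hs => ?_
        simp_rw [← lintegral_indicator_one hs,
          lintegral_map_complete hg _ _ (measurable_one.indicator hs)]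
        exact Measurable.lintegral_prod_right' (ν := seqLaw Q (p + 1) p)
          (f := fun x : ℝ × (Fin p → ℝ) => g (x.1 - ∑ i, x.2 i) *
            s.indicator 1 (complete x.1 x.2))
          ((measurable_slice_density hg).mul
            ((measurable_one.indicator hs).comp measurable_complete)) }

variable {g : ℝ → ℝ≥0∞} (hg : Measurable g)

theorem lintegral_sliceLaw {p : ℕ} (k : ℝ) {F : (Fin (p + 1) → ℝ) → ℝ≥0∞} (hF : Measurable F) :
    ∫⁻ x, F x ∂sliceLaw Q hg (p + 1) k =
      ∫⁻ a, g (k - ∑ i, a i) * F (complete k a) ∂seqLaw Q (p + 1) p :=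
  lintegral_map_complete hg _ k hF

theorem sliceLaw_apply {p : ℕ} (k : ℝ) {s : Set (Fin (p + 1) → ℝ)} (hs : MeasurableSet s) :
    sliceLaw Q hg (p + 1) k s =
      ∫⁻ a, g (k - ∑ i, a i) * s.indicator 1 (complete k a) ∂seqLaw Q (p + 1) p := by
  rw [← lintegral_indicator_one hs, lintegral_sliceLaw Q hg k (measurable_one.indicator hs)]

theorem sliceLaw_univ {p : ℕ} (k : ℝ) :
    sliceLaw Q hg (p + 1) k Set.univ = ∫⁻ a, g (k - ∑ i, a i) ∂seqLaw Q (p + 1) p := by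
  simp [sliceLaw_apply Q hg k MeasurableSet.univ]

theorem sliceLaw_univ_le {C : ℝ≥0∞} (hC : ∀ x, g x ≤ C) (l : ℕ) (k : ℝ) :
    sliceLaw Q hg l k Set.univ ≤ C := by
  cases l with
  | zero => simp [sliceLaw]
  | succ p =>
    rw [sliceLaw_univ]
    calc ∫⁻ a, g (k - ∑ i, a i) ∂seqLaw Q (p + 1) p ≤ ∫⁻ _a, C ∂seqLaw Q (p + 1) p :=
          lintegral_mono fun a => hC _
      _ = C := by simp

theorem isFiniteKernel_sliceLaw {C : ℝ≥0∞} (hC : ∀ x, g x ≤ C) (hCt : C ≠ ∞) (l : ℕ) :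
    IsFiniteKernel (sliceLaw Q hg l) :=
  ⟨C, hCt.lt_top, sliceLaw_univ_le Q hg hC l⟩

theorem sliceLaw_one (k : ℝ) : sliceLaw Q hg 1 k = g k • Measure.dirac fun _ => k := by
  have h1 : seqLaw Q 1 0 = Measure.dirac Fin.elim0 := by
    rw [seqLaw, Measure.pi_of_empty _ Fin.elim0]
  ext s hs
  refine (sliceLaw_apply Q hg (p := 0) k hs).trans ?_
  change ∫⁻ a, g (k - ∑ i, a i) * s.indicator 1 (complete k a) ∂seqLaw Q 1 0 = _
  rw [h1, lintegral_dirac]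
  have : complete k (Fin.elim0 : Fin 0 → ℝ) = fun _ => k := by
    funext i
    simp [complete, join]
  simp only [this]
  simp [hs]

theorem complete_join {r q : ℕ} (k : ℝ) (a : Fin r → ℝ) (b : Fin q → ℝ) :
    complete k (join rfl a b) = join (Nat.add_assoc r q 1) a (complete (k - ∑ i, a i) b) := by
  unfold complete
  rw [join_assoc rfl rfl (Nat.add_assoc r q 1), sum_join, sub_sub]

/-- Fubini over the coordinates before the last. The condition `1 ≤ l` keeps the last variable,
which is the one solved for, in the tail; this is where the density case needs `r < m`. -/
theorem sliceLaw_split {m r l : ℕ} (h : m = r + l) (hl : 1 ≤ l) (k : ℝ) {s : Set (Fin m → ℝ)}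
    (hs : MeasurableSet s) :
    sliceLaw Q hg m k s =
      ∫⁻ a, sliceLaw Q hg l (k - ∑ i, a i) (join h a ⁻¹' s) ∂seqLaw Q m r := by
  obtain ⟨q, rfl⟩ : ∃ q, l = q + 1 := ⟨l - 1, by omega⟩
  subst h
  have hmeas : Measurable fun a : Fin (r + q) → ℝ =>
      g (k - ∑ i, a i) * s.indicator 1 (complete k a) :=
    ((measurable_slice_density hg).comp measurable_prodMk_left).mul
      ((measurable_one.indicator hs).comp (measurable_complete_right k))
  refine (sliceLaw_apply Q hg (p := r + q) k hs).trans ?_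
  rw [lintegral_seqLaw_join Q (r + q + 1) (rfl : r + q = r + q) hmeas]
  refine lintegral_congr fun a => ?_
  rw [sliceLaw_apply Q hg _ (measurable_join_right rfl a hs),
    show r + q + 1 - r = q + 1 by omega]
  refine lintegral_congr fun b => ?_
  rw [complete_join, sum_join, sub_sub]
  rfl

/-- For fixed leading entries `a`, translation invariance replaces the last entry `y` by the total
`k = y + ∑ a`; then the two integrals are exchanged. -/
theorem lintegral_seqLaw_eq_sliceLaw (hQ : Q 0 = volume.withDensity g) {m : ℕ} (hm : 1 ≤ m)
    {F : ℝ × (Fin m → ℝ) → ℝ≥0∞} (hF : Measurable F) :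
    ∫⁻ x, F (∑ i, x i, x) ∂seqLaw Q m m = ∫⁻ k, ∫⁻ x, F (k, x) ∂sliceLaw Q hg m k := by
  obtain ⟨p, rfl⟩ : ∃ p, m = p + 1 := ⟨m - 1, by omega⟩
  have hms : Measurable fun x : Fin (p + 1) → ℝ => F (∑ i, x i, x) := hF.comp (by fun_prop)
  have hmc : Measurable fun x : ℝ × (Fin p → ℝ) =>
      g (x.1 - ∑ i, x.2 i) * F (x.1, complete x.1 x.2) :=
    (measurable_slice_density hg).mul (hF.comp (measurable_fst.prodMk measurable_complete))
  have hs : ∀ k, ∫⁻ x, F (k, x) ∂sliceLaw Q hg (p + 1) k =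
      ∫⁻ a, g (k - ∑ i, a i) * F (k, complete k a) ∂seqLaw Q (p + 1) p := fun k =>
    lintegral_sliceLaw Q hg k (hF.comp (measurable_prodMk_left (x := k)))
  simp_rw [hs]
  rw [lintegral_lintegral_swap hmc.aemeasurable, lintegral_seqLaw_join Q (p + 1) rfl hms]
  refine lintegral_congr fun a => ?_
  have hc : ∀ y : ℝ, join rfl a (fun _ : Fin 1 => y) = complete (y + ∑ i, a i) a := fun y => by
    simp [complete]
  rw [show p + 1 - p = 1 by omega, lintegral_seqLaw_one, Nat.sub_self, hQ]
  simp_rw [hc, sum_complete]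
  refine (lintegral_withDensity_eq_lintegral_mul _ hg
    (hF.comp ((by fun_prop : Measurable fun y : ℝ => y + ∑ i, a i).prodMk
      (measurable_complete.comp
        (by fun_prop : Measurable fun y : ℝ => (y + ∑ i, a i, a)))))).trans ?_
  rw [← lintegral_add_right_eq_self (fun x => g (x - ∑ i, a i) * F (x, complete x a))
    (∑ i, a i)]
  simp

theorem map_sum_seqLaw (hQ : Q 0 = volume.withDensity g) {m : ℕ} (hm : 1 ≤ m) :
    (seqLaw Q m m).map (fun x => ∑ i, x i) =
      volume.withDensity fun k => sliceLaw Q hg m k Set.univ := by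
  ext s hs
  have hmap : Measurable fun x : Fin m → ℝ => ∑ i, x i := by fun_prop
  rw [Measure.map_apply hmap hs, ← lintegral_indicator_one (hmap hs), withDensity_apply _ hs,
    ← lintegral_indicator hs]
  refine (lintegral_seqLaw_eq_sliceLaw Q hg hQ hm (F := fun p => s.indicator 1 p.1)
    ((measurable_one.indicator hs).comp measurable_fst)).trans (lintegral_congr fun k => ?_)
  by_cases hk : k ∈ s <;> simp [hk]

/-! ### Exactness of the sampler in the density case -/

section BoundedDensity

variable {Q} {n : ℕ} {f : ℕ → ℝ → ℝ} {ρ : SplitRule}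

/-- At the sum `k` of the last `l` variables, `f l k` is the mass of the slice, and the sampler
returns the normalized slice. -/
def IsExactAt (Q : ℕ → Measure ℝ) [∀ i, IsProbabilityMeasure (Q i)] {g : ℝ → ℝ≥0∞}
    (hg : Measurable g) (f : ℕ → ℝ → ℝ) (ρ : SplitRule) (l : ℕ) (k : ℝ) : Prop :=
  ENNReal.ofReal (f l k) = sliceLaw Q hg l k Set.univ ∧
    (sliceLaw Q hg l k Set.univ ≠ 0 → sampler f ρ l (tailLaws Q l) k =
      (sliceLaw Q hg l k Set.univ)⁻¹ • sliceLaw Q hg l k)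

theorem sampler_one_eq_normalize {k : ℝ} (hgt : g k ≠ ∞) (hk : sliceLaw Q hg 1 k Set.univ ≠ 0) :
    sampler f ρ 1 (tailLaws Q 1) k = (sliceLaw Q hg 1 k Set.univ)⁻¹ • sliceLaw Q hg 1 k := by
  rw [sliceLaw_one] at hk ⊢
  have hgk : g k ≠ 0 := fun h => hk (by simp [h])
  rw [sampler, smul_smul]
  simp only [Measure.smul_apply, measure_univ, smul_eq_mul, mul_one]
  rw [ENNReal.inv_mul_cancel hgk hgt, one_smul]

theorem sampler_eq_normalize_sliceLaw
    (hf : ∀ m, 1 ≤ m → m ≤ n → IsBoundedDensity (f m) ((seqLaw Q m m).map fun x => ∑ i, x i))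
    (hρ : ∀ m k j, 2 ≤ m → ρ.val m k j < m)
    {C : ℝ≥0∞} (hC : ∀ x, g x ≤ C) (hCt : C ≠ ∞) {m : ℕ} (hm : 2 ≤ m) (hmn : m ≤ n) {k : ℝ}
    (hgood : ∀ r, 1 ≤ r → r < m →
      ∀ᵐ a ∂seqLaw Q m r, IsExactAt Q hg f ρ (m - r) (k - ∑ i, a i))
    (hk : sliceLaw Q hg m k Set.univ ≠ 0) :
    sampler f ρ m (tailLaws Q m) k = (sliceLaw Q hg m k Set.univ)⁻¹ • sliceLaw Q hg m k := by
  have := isFiniteKernel_sliceLaw Q hg hC hCt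
  have hr : ∀ j, 1 ≤ ρ.val m k j ∧ ρ.val m k j < m := fun j => ⟨ρ.one_le m k j, hρ m k j hm⟩
  have hfj : ∀ j, IsBoundedDensity (f (m - ρ.val m k j)) _ := fun j =>
    hf _ (by have := hr j; omega) (by omega)
  refine sampler_tailLaws_step Q f ρ (sliceLaw Q hg) hm hk (fun j => (hfj j).measurable)
    (fun j => (hfj j).nonneg) (fun j => ?_)
    (fun j l h s hs => sliceLaw_split Q hg h (by have := hr j; omega) k hs)
    (fun j => (hgood _ (hr j).1 (hr j).2).mono fun a ha => ha.1)
    (fun j => (hgood _ (hr j).1 (hr j).2).mono fun a ha => ha.2)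
  obtain ⟨C, hC⟩ := (hfj j).bounded
  exact ⟨C, by rintro _ ⟨x, rfl⟩; exact hC x⟩

/-- For each `a` the map `k ↦ k - S a` is a translation, so a Lebesgue null set pulls back to a null
set of the product, whatever `ν` is. -/
theorem ae_ae_sub_of_ae {p : ℝ → Prop} (hp : ∀ᵐ x, p x) {β : Type*} [MeasurableSpace β]
    (ν : Measure β) [SFinite ν] {S : β → ℝ} (hS : Measurable S) :
    ∀ᵐ k, ∀ᵐ a ∂ν, p (k - S a) := by
  have hq : Measure.QuasiMeasurePreserving (fun z : ℝ × β => z.1 - S z.2)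
      (volume.prod ν) volume := by
    refine ⟨by fun_prop, Measure.AbsolutelyContinuous.mk fun s hs h0 => ?_⟩
    have hm : Measurable fun z : ℝ × β => z.1 - S z.2 := by fun_prop
    rw [Measure.map_apply hm hs, Measure.prod_apply_symm (hm hs)]
    refine lintegral_eq_zero_of_ae_eq_zero (ae_of_all _ fun a => ?_)
    change volume ((fun x => x - S a) ⁻¹' s) = 0
    rw [(measurePreserving_sub_right volume (S a)).measure_preimage hs.nullMeasurableSet, h0]
  exact Measure.ae_ae_of_ae_prod (hq.ae hp)

theorem ae_ofReal_eq_sliceLaw_univ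
    (hf : ∀ m, 1 ≤ m → m ≤ n → IsBoundedDensity (f m) ((seqLaw Q m m).map fun x => ∑ i, x i))
    (hQ : Q 0 = volume.withDensity g) {m : ℕ} (hm : 1 ≤ m)
    (hmn : m ≤ n) : ∀ᵐ k, ENNReal.ofReal (f m k) = sliceLaw Q hg m k Set.univ := by
  have h1 := (hf m hm hmn).eq_withDensity
  refine (withDensity_eq_iff (hf m hm hmn).measurable.ennreal_ofReal.aemeasurable
    ((sliceLaw Q hg m).measurable_coe MeasurableSet.univ).aemeasurable ?_).1
    (h1.symm.trans (map_sum_seqLaw Q hg hQ hm))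
  have : IsProbabilityMeasure ((seqLaw Q m m).map fun x => ∑ i, x i) :=
    Measure.isProbabilityMeasure_map (by fun_prop)
  rw [← setLIntegral_univ, ← withDensity_apply _ MeasurableSet.univ, ← h1]
  exact measure_ne_top _ _

/-- The null set excluded at level `m` collects the one where `f m` differs from the slice mass and,
for each of the finitely many relevant `r`, the one where the recursive targets fail to be almost
surely good. -/
theorem ae_isExactAt
    (hf : ∀ m, 1 ≤ m → m ≤ n → IsBoundedDensity (f m) ((seqLaw Q m m).map fun x => ∑ i, x i))
    (hQ : Q 0 = volume.withDensity g)
    (hρ : ∀ m k j, 2 ≤ m → ρ.val m k j < m) {C : ℝ≥0∞} (hC : ∀ x, g x ≤ C) (hCt : C ≠ ∞) {m : ℕ}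
    (hm : 1 ≤ m) (hmn : m ≤ n) : ∀ᵐ k, IsExactAt Q hg f ρ m k := by
  induction m using Nat.strong_induction_on with
  | _ m ih =>
    have h0 := ae_ofReal_eq_sliceLaw_univ hg hf hQ hm hmn
    rcases Nat.lt_or_ge m 2 with h2 | h2
    · obtain rfl : m = 1 := by omega
      filter_upwards [h0] with k hk
      exact ⟨hk, sampler_one_eq_normalize hg (ne_top_of_le_ne_top hCt (hC k))⟩
    · have hgood : ∀ᵐ k, ∀ r, 1 ≤ r → r < m →
          ∀ᵐ a ∂seqLaw Q m r, IsExactAt Q hg f ρ (m - r) (k - ∑ i, a i) := by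
        refine ae_all_iff.2 fun r => ?_
        by_cases hr : 1 ≤ r ∧ r < m
        · have := ae_ae_sub_of_ae (ih (m - r) (by omega) (by omega) (by omega)) (seqLaw Q m r)
            (S := fun a => ∑ i, a i) (by fun_prop)
          filter_upwards [this] with k hk _ _
          exact hk
        · exact ae_of_all _ fun k h1 h2 => absurd ⟨h1, h2⟩ hr
      filter_upwards [h0, hgood] with k hk hgk
      exact ⟨hk, sampler_eq_normalize_sliceLaw hg hf hρ hC hCt h2 hmn hgk⟩

end BoundedDensity

end

section

/-! ### Continuity in the sum -/

/-- If the law of `S` has a bounded density, then integrals against `g (k - S)` depend continuously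
on `k`, for every integrable `g`. -/
theorem continuous_integral_mul_sub {β : Type*} [MeasurableSpace β] {ν : Measure β}
    [IsProbabilityMeasure ν] {S : β → ℝ} (hS : Measurable S) {D : ℝ≥0∞} (hD : D ≠ ∞)
    (hSD : ∀ F : ℝ → ℝ≥0∞, Measurable F → ∫⁻ a, F (S a) ∂ν ≤ D * ∫⁻ x, F x)
    {u : ℝ → ℝ} (hu : Measurable u) (hui : Integrable u) {ψ : ℝ → β → ℝ} {B : ℝ}
    (hψ : ∀ k, Measurable (ψ k)) (hψB : ∀ k a, |ψ k a| ≤ B) (hψc : ∀ a, Continuous fun k => ψ k a) :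
    Continuous fun k => ∫ a, ψ k a * u (k - S a) ∂ν := by
  have hB : 0 ≤ B := by
    have : Nonempty β := ν.nonempty_of_neZero
    exact (abs_nonneg _).trans (hψB 0 (Classical.arbitrary β))
  -- The bound does not depend on `k`, since reflection and translation preserve Lebesgue measure.
  -- It makes the approximation below uniform in `k`.
  have hbound : ∀ v : ℝ → ℝ, Measurable v → Integrable v → ∀ k,
      Integrable (fun a => v (k - S a)) ν ∧
        ∫ a, |v (k - S a)| ∂ν ≤ D.toReal * ∫ x, |v x| := by
    intro v hv hvi k
    have h1 : ∫⁻ a, ‖v (k - S a)‖ₑ ∂ν ≤ D * ∫⁻ x, ‖v x‖ₑ := by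
      refine (hSD (fun x => ‖v (k - x)‖ₑ) (hv.comp (by fun_prop)).enorm).trans ?_
      rw [lintegral_sub_left_eq_self (fun x => ‖v x‖ₑ) k]
    have h2 : D * ∫⁻ x, ‖v x‖ₑ ≠ ∞ := ENNReal.mul_ne_top hD hvi.2.ne
    have hm : Measurable fun a => v (k - S a) := hv.comp (by fun_prop)
    refine ⟨⟨hm.aestronglyMeasurable, h1.trans_lt h2.lt_top⟩, ?_⟩
    have e1 := integral_norm_eq_lintegral_enorm hm.aestronglyMeasurable (μ := ν)
    have e2 := integral_norm_eq_lintegral_enorm hvi.1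
    simp only [Real.norm_eq_abs] at e1 e2
    rw [e1, e2, ← ENNReal.toReal_mul]
    exact ENNReal.toReal_mono h2 h1
  refine continuous_of_uniform_approx_of_continuous fun s hs => ?_
  obtain ⟨ε, hε, hεs⟩ := Metric.uniformity_basis_dist_le.mem_iff.1 hs
  -- An `L¹` error `η` in `u` costs at most `B * D * η`; the added one keeps the divisor positive
  -- when `B * D = 0`.
  have hpos : 0 < B * D.toReal + 1 := by positivity
  obtain ⟨c, hcs, hcle, hcc, hci⟩ :=
    hui.exists_hasCompactSupport_integral_sub_le (div_pos hε hpos)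
  obtain ⟨K, hK⟩ := hcc.bounded_above_of_compact_support hcs
  refine ⟨fun k => ∫ a, ψ k a * c (k - S a) ∂ν, ?_, fun k => hεs ?_⟩
  · refine continuous_of_dominated (bound := fun _ => B * K)
      (fun k => ((hψ k).mul (hcc.measurable.comp (by fun_prop))).aestronglyMeasurable)
      (fun k => ae_of_all _ fun a => ?_) (integrable_const _) (ae_of_all _ fun a => ?_)
    · rw [norm_mul]
      exact mul_le_mul (hψB k a) (hK _) (norm_nonneg _) hB
    · exact (hψc a).mul (hcc.comp (by fun_prop))
  · have hint : ∀ v : ℝ → ℝ, Measurable v → Integrable v →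
        Integrable (fun a => ψ k a * v (k - S a)) ν := fun v hv hvi =>
      (hbound v hv hvi k).1.bdd_mul (hψ k).aestronglyMeasurable
        (ae_of_all _ fun a => by simpa using hψB k a)
    change dist (∫ a, ψ k a * u (k - S a) ∂ν) (∫ a, ψ k a * c (k - S a) ∂ν) ≤ ε
    rw [Real.dist_eq, ← integral_sub (hint u hu hui) (hint c hcc.measurable hci)]
    obtain ⟨hi, hle⟩ := hbound (u - c) (hu.sub hcc.measurable) (hui.sub hci) k
    calc |∫ a, (ψ k a * u (k - S a) - ψ k a * c (k - S a)) ∂ν|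
        ≤ ∫ a, |ψ k a * u (k - S a) - ψ k a * c (k - S a)| ∂ν := abs_integral_le_integral_abs
      _ ≤ ∫ a, B * |(u - c) (k - S a)| ∂ν := by
          refine integral_mono_of_nonneg (ae_of_all _ fun a => abs_nonneg _)
            (hi.abs.const_mul B) (ae_of_all _ fun a => ?_)
          simp only
          rw [← mul_sub, abs_mul]
          exact mul_le_mul_of_nonneg_right (hψB k a) (abs_nonneg _)
      _ = B * ∫ a, |(u - c) (k - S a)| ∂ν := integral_const_mul _ _
      _ ≤ B * (D.toReal * (ε / (B * D.toReal + 1))) := by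
          refine mul_le_mul_of_nonneg_left (hle.trans ?_) hB
          exact mul_le_mul_of_nonneg_left hcle ENNReal.toReal_nonneg
      _ ≤ ε := by
          rw [← mul_assoc, mul_div_assoc', div_le_iff₀ hpos]
          nlinarith

variable (Q : ℕ → Measure ℝ) [∀ i, IsProbabilityMeasure (Q i)]

/-- The sum of independent variables has a bounded density if the first of them has one. -/
theorem lintegral_sum_seqLaw_le {m r : ℕ} (hr : 1 ≤ r) {D : ℝ≥0∞}
    (hD : Q (m - 1) ≤ D • volume) {F : ℝ → ℝ≥0∞} (hF : Measurable F) :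
    ∫⁻ a, F (∑ i, a i) ∂seqLaw Q m r ≤ D * ∫⁻ x, F x := by
  have hm : Measurable fun a : Fin r → ℝ => F (∑ i, a i) := hF.comp (by fun_prop)
  rw [lintegral_seqLaw_join Q m (show r = 1 + (r - 1) by omega) hm]
  simp_rw [sum_join]
  have hm2 : Measurable fun z : (Fin 1 → ℝ) × (Fin (r - 1) → ℝ) =>
      F (∑ i, z.1 i + ∑ i, z.2 i) := hF.comp (by fun_prop)
  rw [lintegral_lintegral_swap hm2.aemeasurable]
  calc ∫⁻ b : Fin (r - 1) → ℝ, ∫⁻ a : Fin 1 → ℝ, F (∑ i, a i + ∑ i, b i) ∂seqLaw Q m 1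
        ∂seqLaw Q (m - 1) (r - 1)
      ≤ ∫⁻ _b : Fin (r - 1) → ℝ, (D * ∫⁻ x, F x) ∂seqLaw Q (m - 1) (r - 1) := by
        refine lintegral_mono fun b => ?_
        simp only
        rw [lintegral_seqLaw_one]
        simp only [Finset.univ_unique, Finset.sum_const, Finset.card_singleton, one_smul]
        refine (lintegral_mono' hD le_rfl).trans ?_
        rw [lintegral_smul_measure, lintegral_add_right_eq_self, smul_eq_mul]
    _ = D * ∫⁻ x, F x := by simp

/-- The replacement for `ae_ae_sub_of_ae` at a fixed `k`: the first variable, of law `Q (m - 1)`,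
makes the law of the head sum absolutely continuous. -/
theorem ae_sub_sum_seqLaw {m r : ℕ} (hr : 1 ≤ r) {D : ℝ≥0∞} (hD : Q (m - 1) ≤ D • volume)
    {p : ℝ → Prop} (hp : ∀ᵐ x, p x) (k : ℝ) : ∀ᵐ a ∂seqLaw Q m r, p (k - ∑ i, a i) := by
  have hm : Measurable fun a : Fin r → ℝ => k - ∑ i, a i := by fun_prop
  have hac : Measure.map (fun a : Fin r → ℝ => k - ∑ i, a i) (seqLaw Q m r) ≪ volume := by
    refine Measure.AbsolutelyContinuous.mk fun s hs h0 => ?_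
    rw [Measure.map_apply hm hs, ← nonpos_iff_eq_zero, ← lintegral_indicator_one (hm hs)]
    refine (lintegral_sum_seqLaw_le Q hr hD (F := fun x => s.indicator 1 (k - x))
      ((measurable_one.indicator hs).comp (by fun_prop))).trans ?_
    rw [lintegral_sub_left_eq_self (fun x => s.indicator (1 : ℝ → ℝ≥0∞) x) k,
      lintegral_indicator_one hs, h0, mul_zero]
  exact ae_of_ae_map hm.aemeasurable (hac.ae_le hp)

variable {u : ℝ → ℝ} (hg : Measurable fun x => ENNReal.ofReal (u x))

theorem integral_sliceLaw (hu0 : ∀ x, 0 ≤ u x) {p : ℕ} (k : ℝ) {φ : (Fin (p + 1) → ℝ) → ℝ}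
    (hφ : Measurable φ) :
    ∫ x, φ x ∂sliceLaw Q hg (p + 1) k =
      ∫ a, φ (complete k a) * u (k - ∑ i, a i) ∂seqLaw Q (p + 1) p := by
  change ∫ x, φ x ∂(((seqLaw Q (p + 1) p).withDensity fun a =>
    ENNReal.ofReal (u (k - ∑ i, a i))).map (complete k)) = _
  have hm : Measurable fun a : Fin p → ℝ => ENNReal.ofReal (u (k - ∑ i, a i)) :=
    hg.comp (by fun_prop : Measurable fun a : Fin p → ℝ => k - ∑ i, a i)
  rw [integral_map (measurable_complete_right k).aemeasurable hφ.aestronglyMeasurable,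
    integral_withDensity_eq_integral_toReal_smul hm
      (ae_of_all _ fun a => ENNReal.ofReal_lt_top)]
  simp only [ENNReal.toReal_ofReal (hu0 _), smul_eq_mul, mul_comm]

/-- With `m ≥ 2` the first variable is among those integrated out, so its bounded density smooths
the last density `u`, which itself need not be continuous. -/
theorem continuous_integral_sliceLaw (hu : Measurable u) (hu0 : ∀ x, 0 ≤ u x)
    (hui : Integrable u) {m : ℕ} (hm : 2 ≤ m) {D : ℝ≥0∞} (hD : Q (m - 1) ≤ D • volume)
    (hDt : D ≠ ∞) (φ : (Fin m → ℝ) →ᵇ ℝ) :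
    Continuous fun k => ∫ x, φ x ∂sliceLaw Q hg m k := by
  obtain ⟨p, rfl⟩ : ∃ p, m = p + 1 := ⟨m - 1, by omega⟩
  simp_rw [fun k => integral_sliceLaw Q hg hu0 k φ.continuous.measurable]
  exact continuous_integral_mul_sub (by fun_prop) hDt
    (fun F hF => lintegral_sum_seqLaw_le Q (by omega) hD hF) hu hui
    (fun k => φ.continuous.measurable.comp (measurable_complete_right k))
    (fun k a => φ.norm_coe_le_norm _) (fun a => φ.continuous.comp (continuous_complete a))

/-- With a single variable nothing is smoothed, and continuity of the density at `k` has to be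
assumed. -/
theorem continuousAt_integral_sliceLaw_one (hu0 : ∀ x, 0 ≤ u x) {k : ℝ} (hk : ContinuousAt u k)
    (φ : (Fin 1 → ℝ) →ᵇ ℝ) : ContinuousAt (fun k => ∫ x, φ x ∂sliceLaw Q hg 1 k) k := by
  simp_rw [sliceLaw_one, integral_smul_measure, integral_dirac, ENNReal.toReal_ofReal (hu0 _),
    smul_eq_mul]
  exact hk.mul (φ.continuous.comp (by fun_prop)).continuousAt

/-! ### Conditioning on small intervals -/

theorem map_seqLaw_eq_compProd {g : ℝ → ℝ≥0∞} (hg : Measurable g) (hQ : Q 0 = volume.withDensity g)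
    {m : ℕ} (hm : 1 ≤ m) [IsFiniteKernel (sliceLaw Q hg m)] :
    (seqLaw Q m m).map (fun x => (∑ i, x i, x)) = volume ⊗ₘ sliceLaw Q hg m := by
  refine Measure.ext_of_lintegral _ fun F hF => ?_
  rw [lintegral_map hF (by fun_prop), Measure.lintegral_compProd hF,
    lintegral_seqLaw_eq_sliceLaw Q hg hQ hm hF]

theorem setIntegral_seqLaw {g : ℝ → ℝ≥0∞} (hg : Measurable g) (hQ : Q 0 = volume.withDensity g)
    {m : ℕ} (hm : 1 ≤ m) [IsFiniteKernel (sliceLaw Q hg m)] {s : Set ℝ} (hs : MeasurableSet s)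
    (φ : (Fin m → ℝ) →ᵇ ℝ) :
    ∫ x in {x | ∑ i, x i ∈ s}, φ x ∂seqLaw Q m m = ∫ k in s, ∫ x, φ x ∂sliceLaw Q hg m k := by
  have hmap : Measurable fun x : Fin m → ℝ => (∑ i, x i, x) := by fun_prop
  have hprob : IsProbabilityMeasure (volume ⊗ₘ sliceLaw Q hg m) := by
    rw [← map_seqLaw_eq_compProd Q hg hQ hm]
    exact Measure.isProbabilityMeasure_map hmap.aemeasurable
  have hφ : Measurable fun z : ℝ × (Fin m → ℝ) => φ z.2 :=
    φ.continuous.measurable.comp measurable_snd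
  have hint : Integrable (fun z : ℝ × (Fin m → ℝ) => φ z.2) (volume ⊗ₘ sliceLaw Q hg m) :=
    Integrable.of_bound hφ.aestronglyMeasurable ‖φ‖
      (ae_of_all _ fun z => φ.norm_coe_le_norm _)
  have h := Measure.setIntegral_compProd hs MeasurableSet.univ
    (hint.integrableOn (s := s ×ˢ Set.univ))
  simp only [Measure.restrict_univ] at h
  rw [← h, ← map_seqLaw_eq_compProd Q hg hQ hm, setIntegral_map (hs.prod MeasurableSet.univ)
    hφ.aestronglyMeasurable hmap.aemeasurable]
  congr 2
  ext x
  simp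

theorem tendsto_setIntegral_ball_div {G : ℝ → ℝ} (hG : StronglyMeasurable G) {k : ℝ}
    (hk : ContinuousAt G k) :
    Tendsto (fun ε : ℝ => (∫ x in Metric.ball k ε, G x) / (2 * ε)) (𝓝[>] 0) (𝓝 (G k)) := by
  have hs : Tendsto (fun ε : ℝ => Metric.ball k ε) (𝓝[>] 0) (𝓝 k).smallSets := by
    refine (tendsto_smallSets_iff).2 fun t ht => ?_
    obtain ⟨ε, hε, hεt⟩ := Metric.mem_nhds_iff.1 ht
    filter_upwards [Ioo_mem_nhdsGT hε] with δ hδ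
    exact (Metric.ball_subset_ball hδ.2.le).trans hεt
  have hm : (fun ε : ℝ => volume.real (Metric.ball k ε)) =ᶠ[𝓝[>] 0] fun ε => 2 * ε := by
    filter_upwards [self_mem_nhdsWithin] with ε hε
    have : (0 : ℝ) < ε := hε
    rw [measureReal_def, Real.volume_ball, ENNReal.toReal_ofReal (by positivity)]
  have h := (hk.integral_sub_linear_isLittleO_ae
    hG.stronglyMeasurableAtFilter hs _ hm).tendsto_div_nhds_zero
  have h' := h.add_const (G k)
  rw [zero_add] at h'
  refine h'.congr' ?_
  filter_upwards [self_mem_nhdsWithin] with ε hε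
  have : (0 : ℝ) < ε := hε
  rw [smul_eq_mul]
  field_simp
  ring

/-- The normalized slice is the conditional law at the point `k` if the slices depend
continuously on the sum near `k`. -/
theorem isCondLawAt_normalize_sliceLaw {Ω : Type*} [MeasurableSpace Ω] {μ : Measure Ω}
    [IsProbabilityMeasure μ] {g : ℝ → ℝ≥0∞} (hg : Measurable g) (hQ : Q 0 = volume.withDensity g)
    {m : ℕ} (hm : 1 ≤ m) [IsFiniteKernel (sliceLaw Q hg m)] {Y : Ω → Fin m → ℝ}
    (hY : Measurable Y) (hYQ : μ.map Y = seqLaw Q m m) {k : ℝ}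
    (hk : sliceLaw Q hg m k Set.univ ≠ 0)
    (hc : ∀ φ : (Fin m → ℝ) →ᵇ ℝ, ContinuousAt (fun k => ∫ x, φ x ∂sliceLaw Q hg m k) k) :
    IsCondLawAt μ Y (fun ω => ∑ i, Y ω i) k
      ((sliceLaw Q hg m k Set.univ)⁻¹ • sliceLaw Q hg m k) := by
  set κ := sliceLaw Q hg m
  have hset : ∀ ε : ℝ, {ω | |∑ i, Y ω i - k| < ε} =
      Y ⁻¹' {x | ∑ i, x i ∈ Metric.ball k ε} := fun ε => by
    ext ω
    simp [Real.dist_eq]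
  have hsm : ∀ ε : ℝ, MeasurableSet {x : Fin m → ℝ | ∑ i, x i ∈ Metric.ball k ε} := fun ε =>
    (by fun_prop : Measurable fun x : Fin m → ℝ => ∑ i, x i) Metric.isOpen_ball.measurableSet
  have hset_int : ∀ (φ : (Fin m → ℝ) →ᵇ ℝ) (ε : ℝ),
      ∫ ω in {ω | |∑ i, Y ω i - k| < ε}, φ (Y ω) ∂μ =
        ∫ y in Metric.ball k ε, ∫ x, φ x ∂κ y := fun φ ε => by
    rw [hset, ← setIntegral_map (hsm ε) φ.continuous.measurable.aestronglyMeasurable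
      hY.aemeasurable, hYQ, setIntegral_seqLaw Q hg hQ hm Metric.isOpen_ball.measurableSet]
  have hlim : ∀ φ : (Fin m → ℝ) →ᵇ ℝ, Tendsto (fun ε : ℝ =>
      (∫ ω in {ω | |∑ i, Y ω i - k| < ε}, φ (Y ω) ∂μ) / (2 * ε)) (𝓝[>] 0)
      (𝓝 (∫ x, φ x ∂κ k)) := fun φ => by
    simp_rw [hset_int]
    refine tendsto_setIntegral_ball_div ?_ (hc φ)
    exact (φ.continuous.stronglyMeasurable).integral_kernel
  have hone : ∀ ε : ℝ, ∫ ω in {ω | |∑ i, Y ω i - k| < ε},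
      (BoundedContinuousFunction.const (Fin m → ℝ) (1 : ℝ)) (Y ω) ∂μ =
        μ.real {ω | |∑ i, Y ω i - k| < ε} := fun ε => by simp
  have hmass : Tendsto (fun ε : ℝ => μ.real {ω | |∑ i, Y ω i - k| < ε} / (2 * ε)) (𝓝[>] 0)
      (𝓝 ((κ k).real Set.univ)) := by
    have := hlim (BoundedContinuousFunction.const _ 1)
    simp_rw [hone] at this
    simpa using this
  have hpos : 0 < (κ k).real Set.univ :=
    ENNReal.toReal_pos hk (measure_ne_top _ _)
  refine ⟨⟨?_⟩, fun ε hε => ?_, fun φ => ?_⟩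
  · rw [Measure.smul_apply, smul_eq_mul, ENNReal.inv_mul_cancel hk (measure_ne_top _ _)]
  -- The limit gives positive probability only for small radii; a larger interval contains a small
  -- one.
  · have hev := (hmass.eventually (lt_mem_nhds hpos)).and (Ioo_mem_nhdsGT hε)
    obtain ⟨δ, hδ, hδε⟩ := hev.exists
    have h1 : 0 < μ.real {ω | |∑ i, Y ω i - k| < δ} := by
      have : 0 < 2 * δ := by linarith [hδε.1]
      exact (div_pos_iff_of_pos_right this).1 hδ
    refine (ENNReal.toReal_pos_iff.1 h1).1.trans_le (measure_mono fun ω hω => ?_)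
    exact lt_trans hω hδε.2
  -- The conditional expectation is a quotient of two interval averages, in which the factor `2 * ε`
  -- cancels.
  · have h := (hlim φ).div hmass hpos.ne'
    rw [integral_smul_measure, ENNReal.toReal_inv, smul_eq_mul, ← measureReal_def,
      inv_mul_eq_div]
    refine h.congr' ?_
    filter_upwards [self_mem_nhdsWithin] with ε hε
    have h2 : (2 * ε : ℝ) ≠ 0 := by
      have : (0 : ℝ) < ε := hε
      positivity
    rw [ProbabilityTheory.cond, integral_smul_measure, ENNReal.toReal_inv, smul_eq_mul,
      ← measureReal_def, inv_mul_eq_div]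
    exact div_div_div_cancel_right₀ h2 _ _

end

section

/-! ### The conditional law of independent variables given their sum -/

theorem IsBoundedDensity.exists_le_smul_volume {f : ℝ → ℝ} {ν : Measure ℝ}
    (h : IsBoundedDensity f ν) : ∃ D : ℝ≥0∞, D ≠ ∞ ∧ ν ≤ D • volume := by
  obtain ⟨C, hC⟩ := h.bounded
  refine ⟨ENNReal.ofReal C, ENNReal.ofReal_ne_top, ?_⟩
  rw [h.eq_withDensity, ← withDensity_const]
  exact withDensity_mono (ae_of_all _ fun x => ENNReal.ofReal_le_ofReal (hC x))

theorem IsBoundedDensity.integrable {f : ℝ → ℝ} {ν : Measure ℝ} [IsFiniteMeasure ν]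
    (h : IsBoundedDensity f ν) : Integrable f := by
  refine ⟨h.measurable.aestronglyMeasurable, ?_⟩
  rw [hasFiniteIntegral_iff_ofReal (ae_of_all _ h.nonneg), ← setLIntegral_univ,
    ← withDensity_apply _ MeasurableSet.univ, ← h.eq_withDensity]
  exact measure_lt_top _ _

/-- A set of full Lebesgue measure is dense, so the functions agree at points arbitrarily close to
`k`. -/
theorem eq_of_ae_eq_of_continuousAt {f h : ℝ → ℝ} (hfh : ∀ᵐ x, f x = h x) {k : ℝ}
    (hf : ContinuousAt f k) (hh : ContinuousAt h k) : f k = h k :=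
  tendsto_nhds_unique_of_frequently_eq hf hh
    (mem_closure_iff_frequently.1 (Measure.dense_of_ae hfh k))

theorem map_sum_seqLaw_one (Q : ℕ → Measure ℝ) : (seqLaw Q 1 1).map (fun x => ∑ i, x i) = Q 0 := by
  ext s hs
  have hm : Measurable fun x : Fin 1 → ℝ => ∑ i, x i := by fun_prop
  rw [Measure.map_apply hm hs, ← lintegral_indicator_one (hm hs), lintegral_seqLaw_one,
    ← lintegral_indicator_one hs]
  refine lintegral_congr fun y => ?_
  change s.indicator 1 (∑ _i : Fin 1, y) = s.indicator 1 y
  simp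

variable {Q : ℕ → Measure ℝ} [∀ i, IsProbabilityMeasure (Q i)]

/-- The normalized slices, as a kernel. -/
def normalizedSlice (Q : ℕ → Measure ℝ) [∀ i, IsProbabilityMeasure (Q i)] {g : ℝ → ℝ≥0∞}
    (hg : Measurable g) (m : ℕ) : Kernel ℝ (Fin m → ℝ) where
  toFun k := (sliceLaw Q hg m k Set.univ)⁻¹ • sliceLaw Q hg m k
  measurable' := Measure.measurable_of_measurable_coe _ fun _ hs =>
    ((sliceLaw Q hg m).measurable_coe MeasurableSet.univ).inv.mul
      ((sliceLaw Q hg m).measurable_coe hs)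

instance {g : ℝ → ℝ≥0∞} (hg : Measurable g) (m : ℕ) : IsFiniteKernel (normalizedSlice Q hg m) :=
  ⟨1, ENNReal.one_lt_top, fun _ => ENNReal.inv_mul_le_one _⟩

theorem map_seqLaw_eq_compProd_normalizedSlice {g : ℝ → ℝ≥0∞} (hg : Measurable g)
    (hQ : Q 0 = volume.withDensity g) {m : ℕ} (hm : 1 ≤ m) [IsFiniteKernel (sliceLaw Q hg m)] :
    (seqLaw Q m m).map (fun x => (∑ i, x i, x)) =
      (seqLaw Q m m).map (fun x => ∑ i, x i) ⊗ₘ normalizedSlice Q hg m := by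
  have hS : Measurable fun x : Fin m → ℝ => ∑ i, x i := by fun_prop
  refine Measure.ext_of_lintegral _ fun F hF => ?_
  have : IsProbabilityMeasure ((seqLaw Q m m).map fun x => ∑ i, x i) :=
    Measure.isProbabilityMeasure_map hS.aemeasurable
  rw [lintegral_map hF (by fun_prop), Measure.lintegral_compProd hF,
    lintegral_seqLaw_eq_sliceLaw Q hg hQ hm hF, map_sum_seqLaw Q hg hQ hm,
    lintegral_withDensity_eq_lintegral_mul _
      ((sliceLaw Q hg m).measurable_coe MeasurableSet.univ) hF.lintegral_kernel_prod_right']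
  refine lintegral_congr fun k => ?_
  change _ = sliceLaw Q hg m k Set.univ *
    ∫⁻ x, F (k, x) ∂((sliceLaw Q hg m k Set.univ)⁻¹ • sliceLaw Q hg m k)
  rw [lintegral_smul_measure, smul_eq_mul, ← mul_assoc]
  by_cases h0 : sliceLaw Q hg m k Set.univ = 0
  · rw [Measure.measure_univ_eq_zero.1 h0]
    simp
  · rw [ENNReal.mul_inv_cancel h0 (measure_ne_top _ _), one_mul]

section

variable {n : ℕ} {f : ℕ → ℝ → ℝ} {ρ : SplitRule} {Ω : Type*} [MeasurableSpace Ω] {μ : Measure Ω}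
  [IsProbabilityMeasure μ] {Y : Ω → Fin n → ℝ}

theorem ae_sampler_eq_condDistrib (hn : 1 ≤ n)
    (hf : ∀ m, 1 ≤ m → m ≤ n → IsBoundedDensity (f m) ((seqLaw Q m m).map fun x => ∑ i, x i))
    (hρ : ∀ m k j, 2 ≤ m → ρ.val m k j < m) (hY : Measurable Y) (hYQ : μ.map Y = seqLaw Q n n) :
    ∀ᵐ k ∂(μ.map fun ω => ∑ i, Y ω i),
      sampler f ρ n (tailLaws Q n) k = condDistrib Y (fun ω => ∑ i, Y ω i) μ k := by
  have hf1 := hf 1 le_rfl hn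
  obtain ⟨C, hC⟩ := hf1.bounded
  have hg := hf1.measurable.ennreal_ofReal
  -- The sum of the last one variable is the last variable itself, so `f 1` supplies the density
  -- used to form the slices.
  have hQ : Q 0 = volume.withDensity fun x => ENNReal.ofReal (f 1 x) := by
    rw [← hf1.eq_withDensity, map_sum_seqLaw_one]
  have hgC : ∀ x, ENNReal.ofReal (f 1 x) ≤ ENNReal.ofReal C := fun x =>
    ENNReal.ofReal_le_ofReal (hC x)
  have := isFiniteKernel_sliceLaw Q hg hgC ENNReal.ofReal_ne_top
  have hS : Measurable fun x : Fin n → ℝ => ∑ i, x i := by fun_prop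
  have hmap : μ.map (fun ω => ∑ i, Y ω i) = (seqLaw Q n n).map fun x => ∑ i, x i := by
    rw [← hYQ, Measure.map_map hS hY]
    rfl
  have hpair : μ.map (fun ω => (∑ i, Y ω i, Y ω)) =
      μ.map (fun ω => ∑ i, Y ω i) ⊗ₘ normalizedSlice Q hg n := by
    rw [hmap, ← map_seqLaw_eq_compProd_normalizedSlice hg hQ hn, ← hYQ,
      Measure.map_map (by fun_prop) hY]
    rfl
  have hcd := condDistrib_ae_eq_of_measure_eq_compProd (fun ω => ∑ i, Y ω i)
    hY.aemeasurable hpair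
  have hex : ∀ᵐ k ∂(μ.map fun ω => ∑ i, Y ω i), sampler f ρ n (tailLaws Q n) k =
      (sliceLaw Q hg n k Set.univ)⁻¹ • sliceLaw Q hg n k := by
    -- The slice mass is the density of the sum, so almost every `k` for the law of the sum means
    -- Lebesgue-almost every `k` with nonzero slice mass.
    rw [hmap, map_sum_seqLaw Q hg hQ hn,
      ae_withDensity_iff ((sliceLaw Q hg n).measurable_coe MeasurableSet.univ)]
    filter_upwards [ae_isExactAt hg hf hQ hρ hgC ENNReal.ofReal_ne_top hn le_rfl] with k hk
    exact hk.2
  filter_upwards [hcd, hex] with k h1 h2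
  rw [h2, h1]
  rfl

theorem isCondLawAt_sampler (hn : 1 ≤ n)
    (hf : ∀ m, 1 ≤ m → m ≤ n → IsBoundedDensity (f m) ((seqLaw Q m m).map fun x => ∑ i, x i))
    (hρ : ∀ m k j, 2 ≤ m → ρ.val m k j < m) (hY : Measurable Y) (hYQ : μ.map Y = seqLaw Q n n)
    {g : ℝ → ℝ} (hfirst : IsBoundedDensity g (Q (n - 1))) {k : ℝ} (hfc : ContinuousAt (f n) k)
    (hfk : 0 < f n k) :
    IsCondLawAt μ Y (fun ω => ∑ i, Y ω i) k (sampler f ρ n (tailLaws Q n) k) := by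
  have hf1 := hf 1 le_rfl hn
  obtain ⟨C, hC⟩ := hf1.bounded
  have hg := hf1.measurable.ennreal_ofReal
  have hQ : Q 0 = volume.withDensity fun x => ENNReal.ofReal (f 1 x) := by
    rw [← hf1.eq_withDensity, map_sum_seqLaw_one]
  have hgC : ∀ x, ENNReal.ofReal (f 1 x) ≤ ENNReal.ofReal C := fun x =>
    ENNReal.ofReal_le_ofReal (hC x)
  have := isFiniteKernel_sliceLaw Q hg hgC ENNReal.ofReal_ne_top
  obtain ⟨D, hDt, hD⟩ := hfirst.exists_le_smul_volume
  have hui : Integrable (f 1) := by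
    have : IsProbabilityMeasure ((seqLaw Q 1 1).map fun x => ∑ i, x i) :=
      Measure.isProbabilityMeasure_map (by fun_prop)
    exact hf1.integrable
  have hc : ∀ φ : (Fin n → ℝ) →ᵇ ℝ,
      ContinuousAt (fun k => ∫ x, φ x ∂sliceLaw Q hg n k) k := by
    intro φ
    rcases Nat.lt_or_ge n 2 with h2 | h2
    · obtain rfl : n = 1 := by omega
      exact continuousAt_integral_sliceLaw_one Q hg hf1.nonneg hfc φ
    · exact (continuous_integral_sliceLaw Q hg hf1.measurable hf1.nonneg hui h2 hD hDt
        φ).continuousAt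
  -- `f n` and the slice mass agree almost everywhere and are both continuous at `k`, so they agree
  -- at `k`, where `f n` is positive.
  have hk : sliceLaw Q hg n k Set.univ ≠ 0 := by
    have hc1 := hc (BoundedContinuousFunction.const _ 1)
    simp only [BoundedContinuousFunction.const_apply, integral_const, smul_eq_mul, mul_one] at hc1
    have hae : ∀ᵐ x, f n x = (sliceLaw Q hg n x).real Set.univ := by
      filter_upwards [ae_ofReal_eq_sliceLaw_univ hg hf hQ hn le_rfl] with x hx
      rw [measureReal_def, ← hx, ENNReal.toReal_ofReal ((hf n hn le_rfl).nonneg x)]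
    intro h0
    rw [eq_of_ae_eq_of_continuousAt hae hfc hc1, measureReal_def, h0] at hfk
    simp at hfk
  have hs : sampler f ρ n (tailLaws Q n) k =
      (sliceLaw Q hg n k Set.univ)⁻¹ • sliceLaw Q hg n k := by
    rcases Nat.lt_or_ge n 2 with h2 | h2
    · obtain rfl : n = 1 := by omega
      exact sampler_one_eq_normalize hg ENNReal.ofReal_ne_top hk
    · refine sampler_eq_normalize_sliceLaw hg hf hρ hgC ENNReal.ofReal_ne_top h2 le_rfl
        (fun r h1 hr => ae_sub_sum_seqLaw Q h1 hD ?_ k) hk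
      exact ae_isExactAt hg hf hQ hρ hgC ENNReal.ofReal_ne_top (by omega) (by omega)
  rw [hs]
  exact isCondLawAt_normalize_sliceLaw Q hg hQ hn hY hYQ hk hc

end

/-! ### The laws of the given variables -/

theorem tailSum_eq {Ω : Type*} {n : ℕ} {X : Fin n → Ω → ℝ} {m : ℕ} (hm : m ≤ n) (ω : Ω) :
    tailSum X m ω = ∑ i : Fin m, X ⟨n - m + i, by omega⟩ ω := by
  symm
  refine Finset.sum_bij (fun i _ => ⟨n - m + i, by omega⟩) (fun i _ => ?_) (fun i _ j _ h => ?_)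
    (fun i hi => ?_) (fun i _ => rfl)
  · simp only [Finset.mem_filter, Finset.mem_univ, true_and]
    omega
  · simp only [Fin.mk.injEq] at h
    ext
    omega
  · simp only [Finset.mem_filter, Finset.mem_univ, true_and] at hi
    refine ⟨⟨i - (n - m), by omega⟩, Finset.mem_univ _, ?_⟩
    ext
    simp only
    omega

section

variable {Ω : Type*} [MeasurableSpace Ω] (μ : Measure Ω) {n : ℕ} (X : Fin n → Ω → ℝ)

/-- The laws of the variables `X`, numbered from the end. -/
def lawFromEnd (i : ℕ) : Measure ℝ :=
  if h : i < n then μ.map (X ⟨n - 1 - i, by omega⟩) else Measure.dirac 0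

variable {X}

theorem tailLaws_lawFromEnd : tailLaws (lawFromEnd μ X) n = fun i => μ.map (X i) := by
  funext i
  have h : n - 1 - (i : ℕ) < n := by omega
  simp only [tailLaws, lawFromEnd, h, dite_true]
  congr 2
  ext
  simp only
  omega

variable [IsProbabilityMeasure μ]

/-- The padding by `Measure.dirac 0` beyond index `n` makes this true for every `i`, as the general
lemmas on `Q` require. -/
theorem isProbabilityMeasure_lawFromEnd (hX : ∀ i, Measurable (X i)) (i : ℕ) :
    IsProbabilityMeasure (lawFromEnd μ X i) := by
  unfold lawFromEnd
  split_ifs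
  · exact Measure.isProbabilityMeasure_map (hX _).aemeasurable
  · infer_instance

theorem map_tail_eq_seqLaw (hX : ∀ i, Measurable (X i)) (hindep : iIndepFun X μ) {m : ℕ}
    (hm : m ≤ n) :
    μ.map (fun ω (i : Fin m) => X ⟨n - m + i, by omega⟩ ω) = seqLaw (lawFromEnd μ X) m m := by
  have hinj : Function.Injective fun i : Fin m => (⟨n - m + i, by omega⟩ : Fin n) := by
    intro i j hij
    simp only [Fin.mk.injEq] at hij
    ext
    omega
  rw [(iIndepFun_iff_map_fun_eq_pi_map fun i => (hX _).aemeasurable).1 (hindep.precomp hinj),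
    seqLaw]
  congr 1
  funext i
  have h : m - 1 - (i : ℕ) < n := by omega
  simp only [lawFromEnd, h, dite_true]
  congr 2
  ext
  simp only
  omega

theorem map_eq_seqLaw (hX : ∀ i, Measurable (X i)) (hindep : iIndepFun X μ) :
    μ.map (fun ω i => X i ω) = seqLaw (lawFromEnd μ X) n n := by
  rw [← map_tail_eq_seqLaw μ hX hindep le_rfl]
  simp

theorem map_tailSum (hX : ∀ i, Measurable (X i)) (hindep : iIndepFun X μ) {m : ℕ} (hm : m ≤ n) :
    μ.map (tailSum X m) = (seqLaw (lawFromEnd μ X) m m).map fun x => ∑ i, x i := by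
  rw [← map_tail_eq_seqLaw μ hX hindep hm, Measure.map_map (by fun_prop) (by fun_prop)]
  congr 1
  funext ω
  exact tailSum_eq hm ω

theorem tailPmf_eq (hX : ∀ i, Measurable (X i)) (hindep : iIndepFun X μ)
    [∀ i, IsProbabilityMeasure (lawFromEnd μ X i)] {m : ℕ} (hm : m ≤ n) (k : ℝ) :
    tailPmf μ X m k = (fiberLaw (lawFromEnd μ X) m k).real Set.univ := by
  have hmeas : Measurable (tailSum X m) := by
    unfold tailSum
    fun_prop
  have hS : Measurable fun x : Fin m → ℝ => ∑ i, x i := by fun_prop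
  have h := congrArg (fun ν => ν {k}) (map_tailSum μ hX hindep hm)
  rw [Measure.map_apply hmeas (measurableSet_singleton k),
    Measure.map_apply hS (measurableSet_singleton k)] at h
  rw [fiberLaw_apply, measureReal_restrict_apply_univ]
  exact congrArg ENNReal.toReal h

end

end

end

end SumSampler


theorem mainTheorem7 {Ω : Type*} [MeasurableSpace Ω] (μ : Measure Ω) [IsProbabilityMeasure μ]
    (n : ℕ) (hn : 0 < n) (X : Fin n → Ω → ℝ) (hX : ∀ i, Measurable (X i))
    (hindep : iIndepFun X μ) (ρ : SumSampler.SplitRule) :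
    -- discrete case
    ((∀ i, SumSampler.IsDiscreteLaw (μ.map (X i))) →
      ∀ k : ℝ, 0 < μ {ω | ∑ i, X i ω = k} →
        SumSampler.sampler (SumSampler.tailPmf μ X) ρ n (fun i => μ.map (X i)) k =
          (μ[|{ω | ∑ i, X i ω = k}]).map (fun ω i => X i ω)) ∧
    -- bounded-density case; `f m` is a bounded density of the sum of the last `m` variables
    (∀ f : ℕ → ℝ → ℝ,
      (∀ m, 1 ≤ m → m ≤ n →
        SumSampler.IsBoundedDensity (f m) (μ.map (SumSampler.tailSum X m))) →
      (∀ m k j, 2 ≤ m → ρ.val m k j < m) →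
      (∀ᵐ k ∂(μ.map fun ω => ∑ i, X i ω),
        SumSampler.sampler f ρ n (fun i => μ.map (X i)) k =
          condDistrib (fun ω i => X i ω) (fun ω => ∑ i, X i ω) μ k) ∧
      ((∀ i, ∃ g : ℝ → ℝ, SumSampler.IsBoundedDensity g (μ.map (X i))) →
        ∀ k : ℝ, ContinuousAt (f n) k → 0 < f n k →
          SumSampler.IsCondLawAt μ (fun ω i => X i ω) (fun ω => ∑ i, X i ω) k
            (SumSampler.sampler f ρ n (fun i => μ.map (X i)) k))) := by
  have := SumSampler.isProbabilityMeasure_lawFromEnd μ hX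
  have hY : Measurable fun ω i => X i ω := measurable_pi_lambda _ hX
  have hYQ := SumSampler.map_eq_seqLaw μ hX hindep
  rw [← SumSampler.tailLaws_lawFromEnd μ]
  refine ⟨fun _ k hk => ?_, fun f hf hρ => ?_⟩
  · have hfib : SumSampler.fiberLaw (SumSampler.lawFromEnd μ X) n k =
        (μ.restrict {ω | ∑ i, X i ω = k}).map fun ω i => X i ω := by
      rw [SumSampler.fiberLaw_apply, ← hYQ,
        Measure.restrict_map hY (SumSampler.measurableSet_sum_eq k)]
      rfl
    have hmass : SumSampler.fiberLaw (SumSampler.lawFromEnd μ X) n k Set.univ =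
        μ {ω | ∑ i, X i ω = k} := by
      rw [hfib, Measure.map_apply hY MeasurableSet.univ, Set.preimage_univ,
        Measure.restrict_apply_univ]
    rw [SumSampler.sampler_eq_normalize_fiberLaw _ ρ
      (fun m hm k => SumSampler.tailPmf_eq μ hX hindep hm k) le_rfl (hmass ▸ hk.ne'), hmass, hfib,
      ProbabilityTheory.cond, Measure.map_smul]
  · have hf' : ∀ m, 1 ≤ m → m ≤ n → SumSampler.IsBoundedDensity (f m)
        ((SumSampler.seqLaw (SumSampler.lawFromEnd μ X) m m).map fun x => ∑ i, x i) :=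
      fun m h1 hm => SumSampler.map_tailSum μ hX hindep hm ▸ hf m h1 hm
    refine ⟨SumSampler.ae_sampler_eq_condDistrib hn hf' hρ hY hYQ, fun hg k hfc hfk => ?_⟩
    -- Index `0` is the first variable, which has number `n - 1` when counted from the end.
    obtain ⟨g, hg⟩ := hg ⟨0, hn⟩
    have hlast : SumSampler.lawFromEnd μ X (n - 1) = μ.map (X ⟨0, hn⟩) := by
      have h : n - 1 < n := by omega
      simp [SumSampler.lawFromEnd, h]
    exact SumSampler.isCondLawAt_sampler hn hf' hρ hY hYQ (hlast ▸ hg) hfc hfk
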